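/- Let $K\subset\mathbb R^2$ be a nonempty compact convex set whose support function $p(\varphi)=\sup\{\langle x,N(\varphi)\rangle : x\in K\}$, $N(\varphi)=(\cos\varphi,\sin\varphi)$, is of class $\mathcal C^2$ with $p+p''>0$ everywhere; that is, $K$ is strictly convex and is bounded by the $\mathcal C^2$ curve $\Gamma=\partial K$, $\gamma=pN+p'N'$, with radius of curvature $p+p''$. Let $F$ be the area of $K$, $L$ the length of $\Gamma$ and $\Delta=L^2-4\pi F$. Let $F_e$ be the area with sign and multiplicities swept by the radius vector of the evolute $\gamma-(p+p'')N$ of $\Gamma$, $0\le\varphi\le 2\pi$, i.e. the limit, as the mesh of the partition $0=\varphi_0\le\dots\le\varphi_n=2\pi$ tends to $0$, of the sums of the signed areas of the triangles with vertices at the origin and at two consecutive points of the evolute. Let $A$ be the area enclosed by the pedal curve of $K$ (the locus of the orthogonal projections on the support lines of $K$) with respect to the Steiner point $\frac1\pi\int_0^{2\pi}p(\varphi)N(\varphi)\,d\varphi$ of $K$. For $P\notin K$ let $\omega=\omega(P)$ be the visual angle of $\Gamma$ from $P$, the angle between the two tangents from $P$ to $\Gamma$, and let $dP$ be the area measure.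 Then $F_e$ exists, $\sin^3\omega$ is integrable over the complement of $K$, and $$\pi|F_e|-\Delta\ \ge\ \frac{40}{9}\left(\pi(A-F)+\frac23L^2-\frac89\int_{P\notin K}\sin^3\omega\,dP\right).$$ The right-hand side is strictly positive except when $\pi|F_e|-\Delta=0$, in which case it also vanishes. Equality holds if and only if one of the following assertions holds: (a) $K$ is a disk or is bounded by a curve parallel to an astroid (the hypocycloid with four cusps); (b) $K$ is bounded by a curve parallel to a Steiner curve (the hypocycloid with three cusps); (c) $K$ is a Minkowski sum of finitely many domains, each bounded by a circle of positive radius, a curve parallel to an astroid or a curve parallel to a Steiner curve. These domains need not be convex, and the sum is taken in the sense of generalized support functions: $p$ is the sum of the generalized support functions of these curves. Here a $\mathcal C^2$ function $f$ is the generalized support function of the envelope $fN+f'N'$ of the lines $x\cos\theta+y\sin\theta=f(\theta)$; the curves parallel to the curve with generalized support function $f$ are those with generalized support function $f+d$, $d\in\mathbb R$; and hypocycloids may be of any size and in any position in the plane. -/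

import Mathlib

open Real MeasureTheory

noncomputable section

namespace Hurwitz

/-- The Euclidean plane. -/
abbrev Plane : Type := EuclideanSpace ℝ (Fin 2)

/-- The unit vector `N(φ) = (cos φ, sin φ)`. -/
def N (φ : ℝ) : Plane := !₂[cos φ, sin φ]

/-- Its derivative `N'(φ) = (-sin φ, cos φ)`. -/
def N' (φ : ℝ) : Plane := !₂[-sin φ, cos φ]

/-- The determinant of two plane vectors. -/
def cross (u v : Plane) : ℝ := u 0 * v 1 - u 1 * v 0

/-- The rotation by the angle `α` about the origin. -/
def rotate (α : ℝ) (v : Plane) : Plane :=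
  !₂[cos α * v 0 - sin α * v 1, sin α * v 0 + cos α * v 1]

/-! ### Convex sets and support functions -/

/-- The support function `p(φ) = sup {⟪x, N φ⟫ : x ∈ K}`. -/
def supp (K : Set Plane) (φ : ℝ) : ℝ := sSup ((fun x : Plane => inner ℝ x (N φ)) '' K)

/-- The envelope of the lines `x cos θ + y sin θ = f θ`, parametrized by the normal angle `θ`:
the curve with generalized support function `f`. -/
def envelope (f : ℝ → ℝ) (θ : ℝ) : Plane := f θ • N θ + deriv f θ • N' θ

/-- The boundary curve of `K`, parametrized by the angle of its outer normal. -/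
def boundary (K : Set Plane) : ℝ → Plane := envelope (supp K)

/-- The radius of curvature `p + p''` of the boundary. -/
def curvRadius (K : Set Plane) (φ : ℝ) : ℝ := supp K φ + deriv (deriv (supp K)) φ

/-- The area of `K`. -/
def area (K : Set Plane) : ℝ := volume.real K

/-- The length of the boundary curve of `K`. -/
def perimeter (K : Set Plane) : ℝ := ∫ φ in (0 : ℝ)..2 * π, ‖deriv (boundary K) φ‖

/-- The isoperimetric deficit `Δ = L² - 4πF`. -/
def deficit (K : Set Plane) : ℝ := perimeter K ^ 2 - 4 * π * area K

/-! ### The evolute and its area with multiplicities -/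

/-- The evolute of the boundary of `K`, i.e. the curve of its centres of curvature. -/
def evolute (K : Set Plane) (φ : ℝ) : Plane := boundary K φ - curvRadius K φ • N φ

/-- `S` is the area, with sign and multiplicities, swept by the radius vector of the curve `c`
between the parameters `a` and `b`: the sums of the signed areas of the triangles with vertices
`0`, `c (t i)`, `c (t (i + 1))` tend to `S` as the mesh of the partition `t` tends to `0`.
For a `C¹` curve this is `½ ∫ (x dy - y dx)`; for a curve that is the envelope of a family with
a `C²` generalized support function `f` it is `½ ∫ f (f + f'')`. -/
def HasSweptArea (c : ℝ → Plane) (a b S : ℝ) : Prop :=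
  ∀ ε > 0, ∃ δ > 0, ∀ (n : ℕ) (t : ℕ → ℝ), t 0 = a → t n = b →
    (∀ i < n, t i ≤ t (i + 1) ∧ t (i + 1) - t i < δ) →
    |(∑ i ∈ Finset.range n, cross (c (t i)) (c (t (i + 1)))) / 2 - S| < ε

/-- The swept area is unique. -/
theorem HasSweptArea.unique {c : ℝ → Plane} {a b S T : ℝ} (hab : a ≤ b)
    (hS : HasSweptArea c a b S) (hT : HasSweptArea c a b T) : S = T := by
  by_contra hne
  have hpos : 0 < |S - T| / 2 := half_pos (abs_pos.mpr (sub_ne_zero.mpr hne))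
  obtain ⟨δ, hδ, h1⟩ := hS _ hpos
  obtain ⟨η, hη, h2⟩ := hT _ hpos
  obtain ⟨n, hn⟩ := exists_nat_gt ((b - a) / min δ η)
  have hm : 0 < min δ η := lt_min hδ hη
  have hn0 : (0 : ℝ) < n := lt_of_le_of_lt (div_nonneg (sub_nonneg.mpr hab) hm.le) hn
  have hstep : (b - a) / n < min δ η := by
    rw [div_lt_iff₀ hm] at hn
    rw [div_lt_iff₀ hn0]
    linarith
  have hge : 0 ≤ (b - a) / n := div_nonneg (sub_nonneg.mpr hab) hn0.le
  have hdiff : ∀ i : ℕ, (a + (i + 1 : ℕ) * ((b - a) / n)) - (a + i * ((b - a) / n))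
      = (b - a) / n := by
    intro i
    push_cast
    ring
  have hend : a + (n : ℝ) * ((b - a) / n) = b := by
    field_simp
    ring
  have e1 := h1 n (fun i => a + i * ((b - a) / n)) (by simp) hend
    (fun i _ => ⟨by linarith [hdiff i], by
      linarith [hdiff i, lt_of_lt_of_le hstep (min_le_left δ η)]⟩)
  have e2 := h2 n (fun i => a + i * ((b - a) / n)) (by simp) hend
    (fun i _ => ⟨by linarith [hdiff i], by
      linarith [hdiff i, lt_of_lt_of_le hstep (min_le_right δ η)]⟩)
  rw [abs_lt] at e1 e2
  have : |S - T| < |S - T| := by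
    rw [abs_lt]
    constructor <;> linarith [e1.1, e1.2, e2.1, e2.2]
  exact lt_irrefl _ this

/-! ### Steiner point and pedal curve -/

/-- The Steiner point `s(K) = (1/π) ∫ p(φ) N(φ) dφ`. -/
def steinerPoint (K : Set Plane) : Plane := (1 / π) • ∫ φ in (0 : ℝ)..2 * π, supp K φ • N φ

/-- The pedal curve of `K` with respect to `O`: the orthogonal projection of `O` on the support
line of `K` with outer normal `N φ`. -/
def pedal (K : Set Plane) (O : Plane) (φ : ℝ) : Plane :=
  O + (supp K φ - inner ℝ O (N φ)) • N φ

/-- The area enclosed by the pedal curve of `K` with respect to the Steiner point. As the Steiner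
point lies in `K`, the curve is star-shaped about it, and the enclosed region is the union of the
segments that join the Steiner point to the curve. -/
def pedalArea (K : Set Plane) : ℝ :=
  volume.real (⋃ φ : ℝ, segment ℝ (steinerPoint K) (pedal K (steinerPoint K) φ))

/-! ### Visual angle -/

/-- The points of `K` in which a support line of `K` through `P` touches `K`. -/
def tangencyPoints (K : Set Plane) (P : Plane) : Set Plane :=
  {x | x ∈ K ∧ ∃ φ : ℝ, inner ℝ x (N φ) = supp K φ ∧ inner ℝ P (N φ) = supp K φ}

/-- The visual angle of the boundary of `K` from the exterior point `P`: the angle at `P` between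
the two tangents from `P`. For a strictly convex `K` there are exactly two points of tangency
`x ≠ y`, so the set below is `{0, ∠ x P y}`. -/
def visualAngle (K : Set Plane) (P : Plane) : ℝ :=
  sSup {ω | ∃ x ∈ tangencyPoints K P, ∃ y ∈ tangencyPoints K P, ω = EuclideanGeometry.angle x P y}

/-- The lower bound `(40/9) (π (A - F) + (2/3) L² - (8/9) ∫_{P ∉ K} sin³ ω dP)`. -/
def pedalBound (K : Set Plane) : ℝ :=
  40 / 9 * (π * (pedalArea K - area K) + 2 / 3 * perimeter K ^ 2
    - 8 / 9 * ∫ P in Kᶜ, sin (visualAngle K P) ^ 3)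

/-! ### Hypocycloids, parallel curves, and sums -/

/-- The hypocycloid with `k` cusps traced by a point of a circle of radius `r` that rolls inside a
circle of radius `k r`. -/
def hypocycloid (k : ℕ) (r t : ℝ) : Plane :=
  !₂[r * (k - 1) * sin t - r * sin ((k - 1) * t), r * (k - 1) * cos t + r * cos ((k - 1) * t)]

/-- `f` is the generalized support function of a hypocycloid with `k` cusps in some position in
the plane: the envelope of the lines `x cos θ + y sin θ = f θ` is a hypocycloid rotated by some
`α` and translated by some `v`, where the normal angle `θ` and the parameter `t` of the hypocycloid
are related by `θ = (k - 2) t / 2 + α`. -/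
def IsHypocycloidSupport (k : ℕ) (f : ℝ → ℝ) : Prop :=
  ContDiff ℝ 2 f ∧ ∃ r > 0, ∃ (α : ℝ) (v : Plane), ∀ t : ℝ,
    envelope f (((k : ℝ) - 2) / 2 * t + α) = rotate α (hypocycloid k r t) + v

/-- `f` is the generalized support function of a curve parallel, at some signed distance `d`, to a
hypocycloid with `k` cusps. Such a curve need not be convex. -/
def IsParallelHypocycloidSupport (k : ℕ) (f : ℝ → ℝ) : Prop :=
  ∃ (g : ℝ → ℝ) (d : ℝ), IsHypocycloidSupport k g ∧ ∀ φ, f φ = g φ + d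

/-- `f` is the support function of a disk of positive radius. -/
def IsDiskSupport (f : ℝ → ℝ) : Prop :=
  ∃ (c : Plane) (ρ : ℝ), 0 < ρ ∧ f = supp (Metric.closedBall c ρ)

/-- `f` is the generalized support function of a circle, of a curve parallel to an astroid
(four cusps) or of a curve parallel to a Steiner curve (three cusps). -/
def IsBasicSupport (f : ℝ → ℝ) : Prop :=
  IsDiskSupport f ∨ IsParallelHypocycloidSupport 4 f ∨ IsParallelHypocycloidSupport 3 f

/-- `K` is a disk of positive radius, or its boundary is parallel to an astroid. -/
def IsDiskOrParallelAstroid (K : Set Plane) : Prop :=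
  (∃ (c : Plane) (ρ : ℝ), 0 < ρ ∧ K = Metric.closedBall c ρ) ∨
    IsParallelHypocycloidSupport 4 (supp K)

/-- The boundary of `K` is parallel to a Steiner curve. -/
def IsParallelSteinerCurve (K : Set Plane) : Prop := IsParallelHypocycloidSupport 3 (supp K)

/-- `K` is a Minkowski sum, in the sense of (generalized) support functions, of finitely many
domains bounded by circles or by curves parallel to an astroid or to a Steiner curve; these
domains need not be convex. -/
def IsMinkowskiSumOfBasic (K : Set Plane) : Prop :=
  ∃ (n : ℕ) (f : Fin n → ℝ → ℝ), (∀ i, IsBasicSupport (f i)) ∧ ∀ φ, supp K φ = ∑ i, f i φ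

end Hurwitz

end

/-!
Every quantity in the theorem is a quadratic form in the support function `p`, and hence a weighted
sum of the energies `|c_n|²` of the Fourier coefficients of `p`.

For areas and lengths this is classical. For `∫ sin³ ω`, describe an exterior point `P` by the
normal angles of the two support lines through it. The Jacobian is the product of the lengths of
the two tangent segments divided by `sin ω`, so the integral becomes a double integral of
`sin² ω` times this product, which is quadratic in `p` and `p'`; integrating out the difference of
the two angles leaves only `∫ p'²` and the harmonics of order at most two.

Divided by `π²`, the two sides of the inequality are `∑ (n² - 1)(n² - 4) |c_n|²` and
`∑ (40/9) n² |c_n|²`, both over `|n| ≥ 3`. The weights agree at `|n| = 3` and the first is larger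
beyond, so equality means that `p` is a trigonometric polynomial of degree at most three. Degree
zero is a circle about the origin, degree one a translation, and the pure harmonics of degree two
and three are the generalized support functions of astroids and of Steiner curves.
-/

namespace Hurwitz

section Plane

@[simp] lemma N_zero (φ : ℝ) : N φ 0 = cos φ := rfl
@[simp] lemma N_one (φ : ℝ) : N φ 1 = sin φ := rfl
@[simp] lemma N'_zero (φ : ℝ) : N' φ 0 = -sin φ := rfl
@[simp] lemma N'_one (φ : ℝ) : N' φ 1 = cos φ := rfl

lemma inner_eq (x y : Plane) : inner ℝ x y = x 0 * y 0 + x 1 * y 1 := by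
  simp [PiLp.inner_apply, Fin.sum_univ_two, mul_comm]

lemma inner_N (x : Plane) (φ : ℝ) : inner ℝ x (N φ) = x 0 * cos φ + x 1 * sin φ := by
  simp [inner_eq]

lemma plane_ext {x y : Plane} (h0 : x 0 = y 0) (h1 : x 1 = y 1) : x = y := by
  ext i; fin_cases i <;> assumption

lemma N_periodic : Function.Periodic N (2 * π) := fun φ => by
  apply plane_ext <;> simp

lemma N'_periodic : Function.Periodic N' (2 * π) := fun φ => by
  apply plane_ext <;> simp

lemma N_add_pi (φ : ℝ) : N (φ + π) = -N φ := by
  apply plane_ext <;> simp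

lemma norm_N (φ : ℝ) : ‖N φ‖ = 1 := by
  simp [EuclideanSpace.norm_eq, Fin.sum_univ_two]

lemma norm_N' (φ : ℝ) : ‖N' φ‖ = 1 := by
  simp [EuclideanSpace.norm_eq, Fin.sum_univ_two]

lemma inner_N_N (φ ψ : ℝ) : inner ℝ (N φ) (N ψ) = cos (ψ - φ) := by
  simp only [inner_N, N_zero, N_one, cos_sub]; ring

lemma inner_N'_N (φ ψ : ℝ) : inner ℝ (N' φ) (N ψ) = sin (ψ - φ) := by
  simp only [inner_N, N'_zero, N'_one, sin_sub]; ring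

lemma inner_N'_N' (φ ψ : ℝ) : inner ℝ (N' φ) (N' ψ) = cos (ψ - φ) := by
  simp only [inner_eq, N'_zero, N'_one, cos_sub]; ring

lemma eq_of_forall_inner_N_eq {x y : Plane} (h : ∀ ψ, inner ℝ x (N ψ) = inner ℝ y (N ψ)) :
    x = y :=
  plane_ext (by simpa [inner_N] using h 0) (by simpa [inner_N] using h (π / 2))

lemma sin_smul_N (a b ψ : ℝ) :
    sin (b - a) • N ψ = sin (b - ψ) • N a + sin (ψ - a) • N b := by
  apply plane_ext <;> simp only [PiLp.smul_apply, PiLp.add_apply, N_zero, N_one, smul_eq_mul,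
    sin_sub] <;> ring

lemma sin_mul_inner_N (x : Plane) (a b ψ : ℝ) : sin (b - a) * inner ℝ x (N ψ) =
    sin (b - ψ) * inner ℝ x (N a) + sin (ψ - a) * inner ℝ x (N b) := by
  rw [← real_inner_smul_right, sin_smul_N, inner_add_right, real_inner_smul_right,
    real_inner_smul_right]

lemma eq_of_inner_N_eq {x y : Plane} {a b : ℝ} (hab : sin (b - a) ≠ 0)
    (ha : inner ℝ x (N a) = inner ℝ y (N a)) (hb : inner ℝ x (N b) = inner ℝ y (N b)) : x = y :=
  eq_of_forall_inner_N_eq fun ψ => mul_left_cancel₀ hab <| by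
    rw [sin_mul_inner_N x, sin_mul_inner_N y, ha, hb]

lemma exists_eq_smul_N (v : Plane) : ∃ φ : ℝ, v = ‖v‖ • N φ := by
  set z : ℂ := v 0 + v 1 * Complex.I with hz
  have hnorm : ‖v‖ = ‖z‖ := by
    rw [EuclideanSpace.norm_eq, hz, Complex.norm_add_mul_I]
    simp [Fin.sum_univ_two]
  rw [hnorm]
  refine ⟨z.arg, plane_ext ?_ ?_⟩
  · exact (by simp [hz] : v 0 = z.re).trans (Complex.norm_mul_cos_arg z).symm
  · exact (by simp [hz] : v 1 = z.im).trans (Complex.norm_mul_sin_arg z).symm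

lemma hasDerivAt_plane {f : ℝ → Plane} {f' : Plane} {x : ℝ}
    (h0 : HasDerivAt (fun t => f t 0) (f' 0) x) (h1 : HasDerivAt (fun t => f t 1) (f' 1) x) :
    HasDerivAt f f' x := by
  rw [hasDerivAt_iff_hasFDerivAt, ← hasFDerivWithinAt_univ, hasFDerivWithinAt_euclidean]
  intro i; fin_cases i
  · exact (h0.hasFDerivAt.congr_fderiv (by ext; simp)).hasFDerivWithinAt
  · exact (h1.hasFDerivAt.congr_fderiv (by ext; simp)).hasFDerivWithinAt

lemma hasDerivAt_N (φ : ℝ) : HasDerivAt N (N' φ) φ :=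
  hasDerivAt_plane (hasDerivAt_cos φ) (hasDerivAt_sin φ)

lemma hasDerivAt_N' (φ : ℝ) : HasDerivAt N' (-N φ) φ :=
  hasDerivAt_plane (hasDerivAt_sin φ).neg (by simpa using hasDerivAt_cos φ)

lemma continuous_N : Continuous N := continuous_iff_continuousAt.2 fun φ =>
  (hasDerivAt_N φ).continuousAt

lemma continuous_N' : Continuous N' := continuous_iff_continuousAt.2 fun φ =>
  (hasDerivAt_N' φ).continuousAt

end Plane

lemma periodic_deriv {f : ℝ → ℝ} {T : ℝ} (hf : Function.Periodic f T) :
    Function.Periodic (deriv f) T := fun x => by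
  rw [← deriv_comp_add_const, show (fun y => f (y + T)) = f from funext hf]

section Envelope

variable {f : ℝ → ℝ}

lemma inner_envelope (f : ℝ → ℝ) (φ ψ : ℝ) :
    inner ℝ (envelope f φ) (N ψ) = f φ * cos (ψ - φ) + deriv f φ * sin (ψ - φ) := by
  rw [envelope, inner_add_left, real_inner_smul_left, real_inner_smul_left, inner_N_N, inner_N'_N]

lemma inner_envelope_self (f : ℝ → ℝ) (φ : ℝ) : inner ℝ (envelope f φ) (N φ) = f φ := by
  simp [inner_envelope]

lemma envelope_periodic (hf : Function.Periodic f (2 * π)) :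
    Function.Periodic (envelope f) (2 * π) := fun φ => by
  simp only [envelope, hf φ, periodic_deriv hf φ, N_periodic φ, N'_periodic φ]

lemma hasDerivAt_envelope (hf : ContDiff ℝ 2 f) (φ : ℝ) :
    HasDerivAt (envelope f) ((f φ + deriv (deriv f) φ) • N' φ) φ := by
  have hf0 := (hf.differentiable two_ne_zero φ).hasDerivAt
  have hf1 := (hf.differentiable_deriv_two φ).hasDerivAt
  refine ((hf0.smul (hasDerivAt_N φ)).add (hf1.smul (hasDerivAt_N' φ))).congr_deriv ?_
  module

lemma continuous_deriv_deriv (hf : ContDiff ℝ 2 f) : Continuous (deriv (deriv f)) :=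
  (ContDiff.deriv' (n := 1) (by simpa [one_add_one_eq_two] using hf)).continuous_deriv le_rfl

end Envelope

/-! ### Support functions with positive radius of curvature -/

/-- The support functions of the strictly convex bodies whose boundary has a continuous positive
radius of curvature `f + f''`. -/
structure IsSmoothSupport (f : ℝ → ℝ) : Prop where
  contDiff : ContDiff ℝ 2 f
  periodic : Function.Periodic f (2 * π)
  curvRadius_pos : ∀ φ, 0 < f φ + deriv (deriv f) φ

namespace IsSmoothSupport

variable {f : ℝ → ℝ} (hf : IsSmoothSupport f)
include hf

lemma hasDerivAt (φ : ℝ) : HasDerivAt f (deriv f φ) φ :=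
  (hf.contDiff.differentiable two_ne_zero φ).hasDerivAt

lemma hasDerivAt_deriv (φ : ℝ) : HasDerivAt (deriv f) (deriv (deriv f) φ) φ :=
  (hf.contDiff.differentiable_deriv_two φ).hasDerivAt

lemma inner_envelope_lt_of_le_pi {φ ψ : ℝ} (hne : φ ≠ ψ) (hle : |φ - ψ| ≤ π) :
    inner ℝ (envelope f φ) (N ψ) < f ψ := by
  have hderiv : ∀ θ, HasDerivAt (fun θ => inner ℝ (envelope f θ) (N ψ))
      ((f θ + deriv (deriv f) θ) * sin (ψ - θ)) θ := fun θ => by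
    simpa [inner_N'_N, real_inner_smul_left] using
      (hasDerivAt_envelope hf.contDiff θ).inner ℝ (hasDerivAt_const θ (N ψ))
  have hcont : Continuous fun θ => inner ℝ (envelope f θ) (N ψ) :=
    continuous_iff_continuousAt.2 fun θ => (hderiv θ).continuousAt
  rw [abs_le] at hle
  rw [← inner_envelope_self f ψ]
  rcases hne.lt_or_gt with hlt | hlt
  · refine strictMonoOn_of_deriv_pos (convex_Icc (ψ - π) ψ) hcont.continuousOn (fun θ hθ => ?_)
      ⟨by linarith, hlt.le⟩ ⟨by linarith [pi_pos], le_rfl⟩ hlt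
    rw [interior_Icc] at hθ
    rw [(hderiv θ).deriv]
    exact mul_pos (hf.curvRadius_pos θ)
      (sin_pos_of_pos_of_lt_pi (by linarith [hθ.2]) (by linarith [hθ.1]))
  · refine strictAntiOn_of_deriv_neg (convex_Icc ψ (ψ + π)) hcont.continuousOn (fun θ hθ => ?_)
      ⟨le_rfl, by linarith [pi_pos]⟩ ⟨hlt.le, by linarith⟩ hlt
    rw [interior_Icc] at hθ
    rw [(hderiv θ).deriv]
    exact mul_neg_of_pos_of_neg (hf.curvRadius_pos θ)
      (sin_neg_of_neg_of_neg_pi_lt (by linarith [hθ.1]) (by linarith [hθ.2]))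

lemma inner_envelope_lt {φ ψ : ℝ} (hlt : φ < ψ) (hlt' : ψ < φ + 2 * π) :
    inner ℝ (envelope f φ) (N ψ) < f ψ := by
  rcases le_total ψ (φ + π) with hle | hle
  · exact hf.inner_envelope_lt_of_le_pi hlt.ne (abs_le.2 ⟨by linarith, by linarith⟩)
  · rw [← envelope_periodic hf.periodic φ]
    exact hf.inner_envelope_lt_of_le_pi hlt'.ne' (abs_le.2 ⟨by linarith, by linarith⟩)

lemma inner_envelope_le (φ ψ : ℝ) : inner ℝ (envelope f φ) (N ψ) ≤ f ψ := by
  obtain ⟨φ', hφ', heq⟩ := (envelope_periodic hf.periodic).exists_mem_Ioc two_pi_pos φ (ψ - 2 * π)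
  rw [heq]
  rcases hφ'.2.lt_or_eq with hlt | rfl
  · exact (hf.inner_envelope_lt (by linarith) (by linarith [hφ'.1])).le
  · simp [inner_envelope_self]

lemma add_pi_pos (φ : ℝ) : 0 < f φ + f (φ + π) := by
  have h := hf.inner_envelope_lt (φ := φ) (ψ := φ + π) (by linarith [pi_pos]) (by linarith [pi_pos])
  rw [N_add_pi, inner_neg_right, inner_envelope_self] at h
  linarith

/-- Strict trigonometric convexity. The boundary point with normal `N ψ`, where `f` agrees with a
sinusoid, lies strictly inside the support lines with normals `N a` and `N b`. -/
lemma sin_mul_lt {a b ψ : ℝ} (ha : a < ψ) (hb : ψ < b) (hab : b < a + π) :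
    sin (b - a) * f ψ < sin (b - ψ) * f a + sin (ψ - a) * f b := by
  have hleft := hf.inner_envelope_lt_of_le_pi ha.ne' (abs_le.2 ⟨by linarith, by linarith⟩)
  have hright := hf.inner_envelope_lt_of_le_pi hb.ne (abs_le.2 ⟨by linarith, by linarith⟩)
  have hsin₁ : 0 < sin (b - ψ) := sin_pos_of_pos_of_lt_pi (by linarith) (by linarith)
  have hsin₂ : 0 < sin (ψ - a) := sin_pos_of_pos_of_lt_pi (by linarith) (by linarith)
  calc sin (b - a) * f ψ = sin (b - a) * inner ℝ (envelope f ψ) (N ψ) := by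
        rw [inner_envelope_self]
    _ = sin (b - ψ) * inner ℝ (envelope f ψ) (N a) +
        sin (ψ - a) * inner ℝ (envelope f ψ) (N b) := sin_mul_inner_N _ _ _ _
    _ < sin (b - ψ) * f a + sin (ψ - a) * f b := by gcongr

/-- The support function of the body translated by `-P`. -/
lemma sub_inner (P : Plane) : IsSmoothSupport fun φ => f φ - inner ℝ P (N φ) := by
  have hderiv : deriv (fun φ => f φ - inner ℝ P (N φ)) = fun φ => deriv f φ - inner ℝ P (N' φ) :=
    funext fun φ => ((hf.hasDerivAt φ).sub
      (by simpa using (hasDerivAt_const φ P).inner ℝ (hasDerivAt_N φ))).deriv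
  have hderiv2 (φ : ℝ) : deriv (deriv fun φ => f φ - inner ℝ P (N φ)) φ =
      deriv (deriv f) φ + inner ℝ P (N φ) := by
    rw [hderiv]
    exact (((hf.hasDerivAt_deriv φ).sub
      (by simpa using (hasDerivAt_const φ P).inner ℝ (hasDerivAt_N' φ))).congr_deriv
      (sub_neg_eq_add _ _)).deriv
  refine ⟨?_, fun φ => by simp only [hf.periodic φ, N_periodic φ], fun φ => ?_⟩
  · have := hf.contDiff
    simp only [inner_N]
    fun_prop
  · rw [hderiv2]
    linarith [hf.curvRadius_pos φ]

lemma neg_of_mem_Ioo {a b ψ : ℝ} (ha : f a = 0) (hb : f b = 0) (hab : b < a + π)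
    (hψ : ψ ∈ Set.Ioo a b) : f ψ < 0 := by
  have hconvex := hf.sin_mul_lt hψ.1 hψ.2 hab
  have hsin : 0 < sin (b - a) :=
    sin_pos_of_pos_of_lt_pi (by linarith [hψ.1, hψ.2]) (by linarith)
  simp only [ha, hb, mul_zero, add_zero] at hconvex
  exact (pos_iff_neg_of_mul_neg hconvex).1 hsin

lemma pos_of_mem_Ioo {a b ψ : ℝ} (ha : f a = 0) (hb : f b = 0) (hlt : a < b) (hab : b < a + π)
    (hψ : ψ ∈ Set.Ioo b (a + 2 * π)) : 0 < f ψ := by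
  have hsin : 0 < sin (b - a) := sin_pos_of_pos_of_lt_pi (by linarith) (by linarith)
  rcases lt_or_ge ψ (a + π) with hψa | hψa
  · have hconvex := hf.sin_mul_lt hlt hψ.1 hψa
    simp only [ha, hb, mul_zero, zero_add] at hconvex
    exact (pos_iff_pos_of_mul_pos hconvex).1 hsin
  rcases le_or_gt ψ (b + π) with hψb | hψb
  · have hwidth := hf.add_pi_pos (ψ - π)
    rw [sub_add_cancel] at hwidth
    suffices f (ψ - π) ≤ 0 by linarith
    rcases eq_or_lt_of_le (show a ≤ ψ - π by linarith) with heq | hlt₁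
    · rw [← heq, ha]
    rcases eq_or_lt_of_le (show ψ - π ≤ b by linarith) with heq | hlt₂
    · rw [heq, hb]
    exact (hf.neg_of_mem_Ioo ha hb hab ⟨hlt₁, hlt₂⟩).le
  · have hconvex := hf.sin_mul_lt (a := ψ - 2 * π) (b := b) (ψ := a) (by linarith [hψ.2]) hlt
      (by linarith)
    simp only [ha, hb, mul_zero, add_zero, hf.periodic.sub_eq] at hconvex
    exact (pos_iff_pos_of_mul_pos hconvex).1 hsin

lemma eq_or_eq_of_eq_zero {a b ψ : ℝ} (ha : f a = 0) (hb : f b = 0) (hlt : a < b)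
    (hab : b < a + π) (hψ : ψ ∈ Set.Ico a (a + 2 * π)) (h : f ψ = 0) : ψ = a ∨ ψ = b := by
  rcases eq_or_lt_of_le hψ.1 with heq | hψa
  · exact .inl heq.symm
  rcases lt_trichotomy ψ b with hψb | hψb | hψb
  · exact absurd h (hf.neg_of_mem_Ioo ha hb hab ⟨hψa, hψb⟩).ne
  · exact .inr hψb
  · exact absurd h (hf.pos_of_mem_Ioo ha hb hlt hab ⟨hψb, hψ.2⟩).ne'

lemma exists_eq_zero_of_neg {ψ : ℝ} (hψ : f ψ < 0) :
    ∃ a b, a < b ∧ b < a + π ∧ f a = 0 ∧ f b = 0 := by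
  have hcont (s : Set ℝ) : ContinuousOn f s := hf.contDiff.continuous.continuousOn
  have hright : 0 < f (ψ + π) := by linarith [hf.add_pi_pos ψ]
  have hleft : 0 < f (ψ - π) := by
    have := hf.add_pi_pos (ψ - π)
    rw [sub_add_cancel] at this
    linarith
  obtain ⟨b, ⟨hψb, hb⟩, hfb⟩ := intermediate_value_Ioo (by linarith [pi_pos]) (hcont _)
    (show (0 : ℝ) ∈ Set.Ioo (f ψ) (f (ψ + π)) from ⟨hψ, hright⟩)
  obtain ⟨a, ⟨ha, haψ⟩, hfa⟩ := intermediate_value_Ioo' (by linarith [pi_pos]) (hcont _)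
    (show (0 : ℝ) ∈ Set.Ioo (f ψ) (f (ψ - π)) from ⟨hψ, hleft⟩)
  refine ⟨a, b, haψ.trans hψb, ?_, hfa, hfb⟩
  have hopp : 0 < f (a + π) := by linarith [hf.add_pi_pos a]
  by_contra! hle
  rcases hle.lt_or_eq with hlt | heq
  · have hconvex := hf.sin_mul_lt (a := ψ) (b := b) (ψ := a + π) (by linarith) hlt hb
    have h₁ : 0 < sin (b - ψ) := sin_pos_of_pos_of_lt_pi (by linarith) (by linarith)
    have h₂ : 0 < sin (b - (a + π)) := sin_pos_of_pos_of_lt_pi (by linarith) (by linarith)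
    rw [hfb, mul_zero] at hconvex
    linarith [mul_pos h₁ hopp, mul_neg_of_pos_of_neg h₂ hψ]
  · exact hopp.ne' (heq ▸ hfb)

end IsSmoothSupport

/-! ### Convex bodies and their support functions -/

lemma inner_smul_N_add_inner_smul_N' (x : Plane) (φ : ℝ) :
    (inner ℝ x (N φ) : ℝ) • N φ + (inner ℝ x (N' φ) : ℝ) • N' φ = x := by
  apply plane_ext <;> simp only [inner_eq, PiLp.add_apply, PiLp.smul_apply, N_zero, N_one, N'_zero,
    N'_one, smul_eq_mul]
  · linear_combination x 0 * sin_sq_add_cos_sq φ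
  · linear_combination x 1 * sin_sq_add_cos_sq φ

lemma eq_envelope_of_inner_le {f : ℝ → ℝ} {x : Plane} {φ : ℝ} (hf : DifferentiableAt ℝ f φ)
    (hle : ∀ ψ, inner ℝ x (N ψ) ≤ f ψ) (heq : inner ℝ x (N φ) = f φ) : x = envelope f φ := by
  have hderiv : HasDerivAt (fun ψ => f ψ - inner ℝ x (N ψ)) (deriv f φ - inner ℝ x (N' φ)) φ :=
    hf.hasDerivAt.sub (by simpa using (hasDerivAt_const φ x).inner ℝ (hasDerivAt_N φ))
  have hmin : IsLocalMin (fun ψ => f ψ - inner ℝ x (N ψ)) φ :=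
    Filter.Eventually.of_forall fun ψ => by simpa [heq] using hle ψ
  rw [envelope, ← heq, sub_eq_zero.1 (hmin.hasDerivAt_eq_zero hderiv),
    inner_smul_N_add_inner_smul_N']

lemma supp_periodic (K : Set Plane) : Function.Periodic (supp K) (2 * π) := fun φ => by
  simp only [supp, N_periodic φ]

lemma inner_le_supp {K : Set Plane} (hK : IsCompact K) {x : Plane} (hx : x ∈ K) (φ : ℝ) :
    inner ℝ x (N φ) ≤ supp K φ :=
  le_csSup (hK.image (by fun_prop)).bddAbove ⟨x, hx, rfl⟩

lemma mem_iff_forall_inner_le_supp {K : Set Plane} (hne : K.Nonempty) (hcpt : IsCompact K)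
    (hconv : Convex ℝ K) {x : Plane} : x ∈ K ↔ ∀ φ, inner ℝ x (N φ) ≤ supp K φ := by
  refine ⟨inner_le_supp hcpt, fun hle => ?_⟩
  by_contra hx
  obtain ⟨l, u, hlu, hux⟩ := geometric_hahn_banach_closed_point hconv hcpt.isClosed hx
  obtain ⟨φ, hφ⟩ := exists_eq_smul_N ((InnerProductSpace.toDual ℝ Plane).symm l)
  set r := ‖(InnerProductSpace.toDual ℝ Plane).symm l‖
  have hl (y : Plane) : l y = r * inner ℝ y (N φ) := by
    rw [← real_inner_smul_right, ← hφ, real_inner_comm, InnerProductSpace.toDual_symm_apply]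
  obtain ⟨y, hy, hmax⟩ : ∃ y ∈ K, supp K φ = inner ℝ y (N φ) := by
    obtain ⟨y, hy, h, -⟩ := hcpt.exists_sSup_image_eq_and_ge hne
      (f := fun x : Plane => inner ℝ x (N φ)) (by fun_prop)
    exact ⟨y, hy, h⟩
  have hly := hlu y hy
  rw [hl] at hly hux
  have := mul_le_mul_of_nonneg_left ((hle φ).trans hmax.le) (norm_nonneg _ : 0 ≤ r)
  linarith

/-- The convex bodies of the theorem: nonempty, compact, convex, with smooth support function. -/
structure IsSmoothBody (K : Set Plane) : Prop where
  nonempty : K.Nonempty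
  isCompact : IsCompact K
  convex : Convex ℝ K
  isSmoothSupport : IsSmoothSupport (supp K)

lemma IsSmoothBody.mem_iff {K : Set Plane} (hK : IsSmoothBody K) {x : Plane} :
    x ∈ K ↔ ∀ φ, inner ℝ x (N φ) ≤ supp K φ :=
  mem_iff_forall_inner_le_supp hK.nonempty hK.isCompact hK.convex

lemma IsSmoothBody.boundary_mem {K : Set Plane} (hK : IsSmoothBody K) (φ : ℝ) :
    boundary K φ ∈ K :=
  hK.mem_iff.2 (hK.isSmoothSupport.inner_envelope_le φ)

/-! ### Exterior points as intersections of two support lines -/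

/-- The length of the tangent from the point with normal angle `φ` of the envelope of `f` to the
tangent with normal angle `φ + τ`. -/
noncomputable def tangentLeft (f : ℝ → ℝ) (φ τ : ℝ) : ℝ :=
  (f (φ + τ) - inner ℝ (envelope f φ) (N (φ + τ))) / sin τ

/-- The length of the tangent from the point with normal angle `φ + τ` of the envelope of `f` to
the tangent with normal angle `φ`. -/
noncomputable def tangentRight (f : ℝ → ℝ) (φ τ : ℝ) : ℝ :=
  (f φ - inner ℝ (envelope f (φ + τ)) (N φ)) / sin τ

/-- The intersection of the tangents of the envelope of `f` with normal angles `x.1` and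
`x.1 + x.2`. -/
noncomputable def corner (f : ℝ → ℝ) (x : ℝ × ℝ) : Plane :=
  envelope f x.1 + tangentLeft f x.1 x.2 • N' x.1

/-- The parameters `(φ, τ)` of the points outside a convex curve: `φ` and `φ + τ` are the normal
angles of the two tangents through the point. -/
def cornerDomain : Set (ℝ × ℝ) := Set.Ico 0 (2 * π) ×ˢ Set.Ioo 0 π

lemma measurableSet_cornerDomain : MeasurableSet cornerDomain :=
  measurableSet_Ico.prod measurableSet_Ioo

section Corner

variable {f : ℝ → ℝ} {φ τ : ℝ}

lemma tangentLeft_eq (f : ℝ → ℝ) (φ τ : ℝ) :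
    tangentLeft f φ τ = (f (φ + τ) - f φ * cos τ - deriv f φ * sin τ) / sin τ := by
  rw [tangentLeft, inner_envelope, add_sub_cancel_left, sub_add_eq_sub_sub]

lemma tangentRight_eq (f : ℝ → ℝ) (φ τ : ℝ) : tangentRight f φ τ =
    (f φ - f (φ + τ) * cos τ + deriv f (φ + τ) * sin τ) / sin τ := by
  rw [tangentRight, inner_envelope, sub_add_cancel_left, cos_neg, sin_neg]
  ring

lemma inner_add_smul_N' (x : Plane) (t φ ψ : ℝ) :
    inner ℝ (x + t • N' φ) (N ψ) = inner ℝ x (N ψ) + t * sin (ψ - φ) := by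
  rw [inner_add_left, real_inner_smul_left, inner_N'_N]

lemma inner_corner_left (f : ℝ → ℝ) (φ τ : ℝ) : inner ℝ (corner f (φ, τ)) (N φ) = f φ := by
  simp [corner, inner_add_smul_N', inner_envelope_self]

lemma inner_corner_right (f : ℝ → ℝ) (φ : ℝ) (hτ : sin τ ≠ 0) :
    inner ℝ (corner f (φ, τ)) (N (φ + τ)) = f (φ + τ) := by
  rw [corner, inner_add_smul_N', tangentLeft, add_sub_cancel_left, div_mul_cancel₀ _ hτ,
    add_sub_cancel]

lemma corner_eq_of_inner_eq {P : Plane} (hτ : sin τ ≠ 0) (hleft : inner ℝ P (N φ) = f φ)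
    (hright : inner ℝ P (N (φ + τ)) = f (φ + τ)) : corner f (φ, τ) = P :=
  eq_of_inner_N_eq (a := φ) (b := φ + τ) (by rwa [add_sub_cancel_left])
    ((inner_corner_left f φ τ).trans hleft.symm) ((inner_corner_right f φ hτ).trans hright.symm)

lemma corner_eq_envelope_sub (f : ℝ → ℝ) (φ : ℝ) (hτ : sin τ ≠ 0) :
    corner f (φ, τ) = envelope f (φ + τ) + (-tangentRight f φ τ) • N' (φ + τ) := by
  refine corner_eq_of_inner_eq hτ ?_ ?_
  · rw [inner_add_smul_N', sub_add_cancel_left, sin_neg, neg_mul_neg, tangentRight,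
      div_mul_cancel₀ _ hτ, add_sub_cancel]
  · rw [inner_add_smul_N', inner_envelope_self, sub_self, sin_zero, mul_zero, add_zero]

lemma corner_add_two_pi (hf : Function.Periodic f (2 * π)) (φ τ : ℝ) :
    corner f (φ + 2 * π, τ) = corner f (φ, τ) := by
  simp only [corner, tangentLeft, envelope_periodic hf φ, add_right_comm φ (2 * π), hf (φ + τ),
    N_periodic (φ + τ), N'_periodic φ]

end Corner

namespace IsSmoothSupport

variable {f : ℝ → ℝ} (hf : IsSmoothSupport f) {φ τ : ℝ}
include hf

lemma tangentLeft_pos (hτ : τ ∈ Set.Ioo 0 π) : 0 < tangentLeft f φ τ :=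
  div_pos (sub_pos.2 (hf.inner_envelope_lt (by linarith [hτ.1]) (by linarith [hτ.1, hτ.2])))
    (sin_pos_of_mem_Ioo hτ)

lemma tangentRight_pos (hτ : τ ∈ Set.Ioo 0 π) : 0 < tangentRight f φ τ :=
  div_pos (sub_pos.2 (hf.inner_envelope_lt_of_le_pi (by linarith [hτ.1])
    (abs_le.2 ⟨by linarith [hτ.1, pi_pos], by linarith [hτ.2]⟩))) (sin_pos_of_mem_Ioo hτ)

lemma lt_inner_corner (hτ : τ ∈ Set.Ioo 0 π) {ψ : ℝ} (hψ : ψ ∈ Set.Ioo φ (φ + τ)) :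
    f ψ < inner ℝ (corner f (φ, τ)) (N ψ) :=
  sub_neg.1 ((hf.sub_inner (corner f (φ, τ))).neg_of_mem_Ioo
    (sub_eq_zero.2 (inner_corner_left f φ τ).symm)
    (sub_eq_zero.2 (inner_corner_right f φ (sin_pos_of_mem_Ioo hτ).ne').symm)
    (by linarith [hτ.2]) hψ)

lemma inner_corner_lt (hτ : τ ∈ Set.Ioo 0 π) {ψ : ℝ} (hψ : ψ ∈ Set.Ioo (φ + τ) (φ + 2 * π)) :
    inner ℝ (corner f (φ, τ)) (N ψ) < f ψ :=
  sub_pos.1 ((hf.sub_inner (corner f (φ, τ))).pos_of_mem_Ioo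
    (sub_eq_zero.2 (inner_corner_left f φ τ).symm)
    (sub_eq_zero.2 (inner_corner_right f φ (sin_pos_of_mem_Ioo hτ).ne').symm)
    (by linarith [hτ.1]) (by linarith [hτ.2]) hψ)

lemma eq_or_eq_of_inner_corner_eq (hτ : τ ∈ Set.Ioo 0 π) {ψ : ℝ}
    (hψ : ψ ∈ Set.Ico φ (φ + 2 * π)) (h : inner ℝ (corner f (φ, τ)) (N ψ) = f ψ) :
    ψ = φ ∨ ψ = φ + τ :=
  (hf.sub_inner (corner f (φ, τ))).eq_or_eq_of_eq_zero
    (sub_eq_zero.2 (inner_corner_left f φ τ).symm)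
    (sub_eq_zero.2 (inner_corner_right f φ (sin_pos_of_mem_Ioo hτ).ne').symm)
    (by linarith [hτ.1]) (by linarith [hτ.2]) hψ (sub_eq_zero.2 h.symm)

lemma corner_eq_corner_iff {φ' τ' : ℝ} (hτ : τ ∈ Set.Ioo 0 π) (hτ' : τ' ∈ Set.Ioo 0 π)
    (hφ' : φ' ∈ Set.Ico φ (φ + 2 * π)) :
    corner f (φ, τ) = corner f (φ', τ') ↔ φ = φ' ∧ τ = τ' := by
  refine ⟨fun h => ?_, by rintro ⟨rfl, rfl⟩; rfl⟩
  have hleft : inner ℝ (corner f (φ, τ)) (N φ') = f φ' := h ▸ inner_corner_left f φ' τ'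
  have hright : inner ℝ (corner f (φ, τ)) (N (φ' + τ')) = f (φ' + τ') :=
    h ▸ inner_corner_right f φ' (sin_pos_of_mem_Ioo hτ').ne'
  rcases hf.eq_or_eq_of_inner_corner_eq hτ hφ' hleft with rfl | rfl
  · rcases hf.eq_or_eq_of_inner_corner_eq hτ
      ⟨by linarith [hτ'.1], by linarith [hτ'.2, pi_pos]⟩ hright with h' | h'
    · linarith [hτ'.1]
    · exact ⟨rfl, (add_left_cancel h').symm⟩
  · exact absurd hright
      (hf.inner_corner_lt hτ ⟨by linarith [hτ'.1], by linarith [hτ.2, hτ'.2]⟩).ne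

lemma injOn_corner : cornerDomain.InjOn (corner f) := by
  rintro ⟨φ, τ⟩ ⟨hφ, hτ⟩ ⟨φ', τ'⟩ ⟨hφ', hτ'⟩ heq
  simp only [Set.mem_Ico] at hφ hφ'
  rcases le_total φ φ' with hle | hle
  · obtain ⟨rfl, rfl⟩ := (hf.corner_eq_corner_iff hτ hτ' ⟨hle, by linarith⟩).1 heq
    rfl
  · obtain ⟨rfl, rfl⟩ := (hf.corner_eq_corner_iff hτ' hτ ⟨hle, by linarith⟩).1 heq.symm
    rfl

lemma exists_corner_eq {P : Plane} {ψ : ℝ} (hP : f ψ < inner ℝ P (N ψ)) :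
    ∃ x ∈ cornerDomain, corner f x = P := by
  obtain ⟨a, b, hab, hba, ha, hb⟩ := (hf.sub_inner P).exists_eq_zero_of_neg (sub_neg.2 hP)
  have hτ : b - a ∈ Set.Ioo 0 π := ⟨by linarith, by linarith⟩
  have hcorner : corner f (a, b - a) = P :=
    corner_eq_of_inner_eq (sin_pos_of_mem_Ioo hτ).ne' (sub_eq_zero.1 ha).symm
      (by rw [add_sub_cancel]; exact (sub_eq_zero.1 hb).symm)
  obtain ⟨φ, hφ, heq⟩ := Function.Periodic.exists_mem_Ico₀ (f := fun φ => corner f (φ, b - a))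
    (fun φ => corner_add_two_pi hf.periodic φ (b - a)) two_pi_pos a
  exact ⟨(φ, b - a), ⟨hφ, hτ⟩, heq.symm.trans hcorner⟩

end IsSmoothSupport

namespace IsSmoothBody

variable {K : Set Plane} (hK : IsSmoothBody K) {φ τ : ℝ}
include hK

lemma corner_notMem (hτ : τ ∈ Set.Ioo 0 π) : corner (supp K) (φ, τ) ∉ K := fun hmem =>
  (hK.mem_iff.1 hmem (φ + τ / 2)).not_gt
    (hK.isSmoothSupport.lt_inner_corner hτ ⟨by linarith [hτ.1], by linarith [hτ.1]⟩)

lemma image_corner : corner (supp K) '' cornerDomain = Kᶜ := by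
  ext P
  constructor
  · rintro ⟨⟨φ, τ⟩, ⟨-, hτ⟩, rfl⟩
    exact hK.corner_notMem hτ
  · intro hP
    rw [Set.mem_compl_iff, hK.mem_iff] at hP
    push Not at hP
    exact hK.isSmoothSupport.exists_corner_eq hP.choose_spec

lemma tangencyPoints_corner (hτ : τ ∈ Set.Ioo 0 π) :
    tangencyPoints K (corner (supp K) (φ, τ)) = {boundary K φ, boundary K (φ + τ)} := by
  have hf := hK.isSmoothSupport
  ext x
  constructor
  · rintro ⟨hx, ψ, hxψ, hPψ⟩
    have hper : Function.Periodic (fun ψ => (boundary K ψ, supp K ψ, N ψ)) (2 * π) := fun ψ => by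
      simp only [boundary, envelope_periodic hf.periodic ψ, hf.periodic ψ, N_periodic ψ]
    obtain ⟨ψ', hψ', heq⟩ := hper.exists_mem_Ico two_pi_pos ψ φ
    obtain ⟨hboundary, hsupp, hN⟩ : boundary K ψ = boundary K ψ' ∧ supp K ψ = supp K ψ' ∧
        N ψ = N ψ' := by simpa only [Prod.mk.injEq] using heq
    have hxb : x = boundary K ψ :=
      eq_envelope_of_inner_le (hf.hasDerivAt ψ).differentiableAt (hK.mem_iff.1 hx) hxψ
    rw [hsupp, hN] at hPψ
    rw [hxb, hboundary]
    rcases hf.eq_or_eq_of_inner_corner_eq hτ hψ' hPψ with rfl | rfl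
    · exact .inl rfl
    · exact .inr rfl
  · rintro (rfl | rfl)
    · exact ⟨hK.boundary_mem φ, φ, inner_envelope_self _ _, inner_corner_left _ _ _⟩
    · exact ⟨hK.boundary_mem _, φ + τ, inner_envelope_self _ _,
        inner_corner_right _ _ (sin_pos_of_mem_Ioo hτ).ne'⟩

end IsSmoothBody

lemma IsSmoothSupport.angle_corner {f : ℝ → ℝ} (hf : IsSmoothSupport f) (φ : ℝ) {τ : ℝ}
    (hτ : τ ∈ Set.Ioo 0 π) :
    EuclideanGeometry.angle (envelope f φ) (corner f (φ, τ)) (envelope f (φ + τ)) = π - τ := by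
  have hleft : envelope f φ -ᵥ corner f (φ, τ) = -(tangentLeft f φ τ • N' φ) := by
    simp [corner]
  have hright : envelope f (φ + τ) -ᵥ corner f (φ, τ) = tangentRight f φ τ • N' (φ + τ) := by
    simp [corner_eq_envelope_sub f φ (sin_pos_of_mem_Ioo hτ).ne']
  rw [EuclideanGeometry.angle, hleft, hright, InnerProductGeometry.angle_neg_left,
    InnerProductGeometry.angle_smul_left_of_pos _ _ (hf.tangentLeft_pos hτ),
    InnerProductGeometry.angle_smul_right_of_pos _ _ (hf.tangentRight_pos hτ),
    InnerProductGeometry.angle, norm_N', norm_N', inner_N'_N', add_sub_cancel_left, mul_one,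
    div_one, arccos_cos hτ.1.le hτ.2.le]

lemma IsSmoothBody.visualAngle_corner {K : Set Plane} (hK : IsSmoothBody K) (φ : ℝ) {τ : ℝ}
    (hτ : τ ∈ Set.Ioo 0 π) : visualAngle K (corner (supp K) (φ, τ)) = π - τ := by
  have hne (ψ : ℝ) : boundary K ψ ≠ corner (supp K) (φ, τ) := fun h =>
    hK.corner_notMem hτ (h ▸ hK.boundary_mem ψ)
  have hangle : EuclideanGeometry.angle (boundary K φ) (corner (supp K) (φ, τ))
      (boundary K (φ + τ)) = π - τ := hK.isSmoothSupport.angle_corner φ hτ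
  have hangles : {ω | ∃ x ∈ tangencyPoints K (corner (supp K) (φ, τ)),
      ∃ y ∈ tangencyPoints K (corner (supp K) (φ, τ)),
        ω = EuclideanGeometry.angle x (corner (supp K) (φ, τ)) y} = {0, π - τ} := by
    ext ω
    simp only [hK.tangencyPoints_corner hτ, Set.mem_ofPred_eq, Set.mem_insert_iff,
      Set.mem_singleton_iff, exists_eq_or_imp, exists_eq_left, hangle,
      EuclideanGeometry.angle_self_of_ne (hne _),
      EuclideanGeometry.angle_comm (boundary K (φ + τ)) _ (boundary K φ)]
    tauto
  rw [visualAngle, hangles, csSup_pair]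
  exact max_eq_right (by linarith [hτ.2])

/-! ### Change of variables in the plane -/

/-- The Cartesian coordinates, as a measurable equivalence. -/
noncomputable def coordEquiv : Plane ≃ᵐ ℝ × ℝ :=
  (MeasurableEquiv.toLp 2 (Fin 2 → ℝ)).symm.trans MeasurableEquiv.finTwoArrow

/-- The Cartesian coordinates, as a continuous linear map. -/
noncomputable def coordCLM : Plane →L[ℝ] ℝ × ℝ :=
  (EuclideanSpace.proj (𝕜 := ℝ) (0 : Fin 2)).prod (EuclideanSpace.proj (𝕜 := ℝ) (1 : Fin 2))

lemma coordCLM_apply (x : Plane) : coordCLM x = (x 0, x 1) := rfl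

lemma measurePreserving_coordEquiv : MeasurePreserving coordEquiv :=
  (PiLp.volume_preserving_ofLp (Fin 2)).trans (volume_preserving_finTwoArrow ℝ)

/-- The linear map with columns `u` and `v`; the Jacobian of a parametrization of a plane region
is given in this form. -/
noncomputable def columns (u v : Plane) : ℝ × ℝ →L[ℝ] Plane :=
  (ContinuousLinearMap.fst ℝ ℝ ℝ).smulRight u + (ContinuousLinearMap.snd ℝ ℝ ℝ).smulRight v

lemma columns_apply (u v : Plane) (x : ℝ × ℝ) : columns u v x = x.1 • u + x.2 • v := rfl

lemma det_columns (u v : Plane) : ((columns u v).comp coordCLM).det = cross u v := by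
  change LinearMap.det ((columns u v).comp coordCLM : Plane →ₗ[ℝ] Plane) = _
  rw [← LinearMap.det_toMatrix (EuclideanSpace.basisFun (Fin 2) ℝ).toBasis, Matrix.det_fin_two]
  simp [LinearMap.toMatrix_apply, columns_apply, coordCLM_apply, cross]
  ring

section ChangeOfVariables

variable {S : Set (ℝ × ℝ)} {Φ : ℝ × ℝ → Plane} {u v : ℝ × ℝ → Plane}

lemma hasFDerivWithinAt_comp_coordEquiv
    (hd : ∀ x ∈ S, HasFDerivWithinAt Φ (columns (u x) (v x)) S x) :
    ∀ x ∈ coordEquiv ⁻¹' S, HasFDerivWithinAt (Φ ∘ coordEquiv)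
      ((columns (u (coordEquiv x)) (v (coordEquiv x))).comp coordCLM) (coordEquiv ⁻¹' S) x :=
  fun x hx => (hd _ hx).comp x coordCLM.hasFDerivWithinAt fun _ h => h

lemma image_comp_coordEquiv (S : Set (ℝ × ℝ)) (Φ : ℝ × ℝ → Plane) :
    (Φ ∘ coordEquiv) '' (coordEquiv ⁻¹' S) = Φ '' S := by
  rw [Set.image_comp, Set.image_preimage_eq _ coordEquiv.surjective]

lemma injOn_comp_coordEquiv (hinj : S.InjOn Φ) : (coordEquiv ⁻¹' S).InjOn (Φ ∘ coordEquiv) :=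
  hinj.comp coordEquiv.injective.injOn fun _ h => h

lemma setIntegral_image_eq (hS : MeasurableSet S)
    (hd : ∀ x ∈ S, HasFDerivWithinAt Φ (columns (u x) (v x)) S x) (hinj : S.InjOn Φ)
    (f : Plane → ℝ) : ∫ P in Φ '' S, f P = ∫ x in S, |cross (u x) (v x)| * f (Φ x) := by
  rw [← image_comp_coordEquiv, integral_image_eq_integral_abs_det_fderiv_smul volume
    (coordEquiv.measurable hS) (hasFDerivWithinAt_comp_coordEquiv hd) (injOn_comp_coordEquiv hinj)]
  simp only [det_columns, smul_eq_mul, Function.comp]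
  exact measurePreserving_coordEquiv.setIntegral_preimage_emb coordEquiv.measurableEmbedding
    (fun x => |cross (u x) (v x)| * f (Φ x)) S

lemma integrableOn_image_iff (hS : MeasurableSet S)
    (hd : ∀ x ∈ S, HasFDerivWithinAt Φ (columns (u x) (v x)) S x) (hinj : S.InjOn Φ)
    (f : Plane → ℝ) : IntegrableOn f (Φ '' S) ↔
      IntegrableOn (fun x => |cross (u x) (v x)| * f (Φ x)) S := by
  rw [← image_comp_coordEquiv, integrableOn_image_iff_integrableOn_abs_det_fderiv_smul volume
    (coordEquiv.measurable hS) (hasFDerivWithinAt_comp_coordEquiv hd) (injOn_comp_coordEquiv hinj)]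
  simp only [det_columns, smul_eq_mul, Function.comp]
  exact measurePreserving_coordEquiv.integrableOn_comp_preimage coordEquiv.measurableEmbedding
    (f := fun x => |cross (u x) (v x)| * f (Φ x))

end ChangeOfVariables

section Rectangle

variable {E : ℝ × ℝ → ℝ} {a b c d : ℝ} {s t : Set ℝ}

lemma integrableOn_rectangle (hE : Continuous E) (hs : s =ᵐ[volume] Set.Ioc a b)
    (ht : t =ᵐ[volume] Set.Ioc c d) : IntegrableOn E (s ×ˢ t) :=
  ((hE.continuousOn.integrableOn_compact (isCompact_Icc.prod isCompact_Icc)).mono_set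
    (Set.prod_mono Set.Ioc_subset_Icc_self Set.Ioc_subset_Icc_self)).congr_set_ae
    (Measure.set_prod_ae_eq hs ht)

lemma setIntegral_rectangle (hE : Continuous E) (hab : a ≤ b) (hcd : c ≤ d)
    (hs : s =ᵐ[volume] Set.Ioc a b) (ht : t =ᵐ[volume] Set.Ioc c d) :
    ∫ x in s ×ˢ t, E x = ∫ φ in a..b, ∫ τ in c..d, E (φ, τ) := by
  rw [Measure.volume_eq_prod, setIntegral_congr_set (Measure.set_prod_ae_eq hs ht),
    setIntegral_prod _ (integrableOn_rectangle hE .rfl .rfl), intervalIntegral.integral_of_le hab]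
  simp_rw [intervalIntegral.integral_of_le hcd]

lemma integral_swap_of_continuous (hE : Continuous E) (hab : a ≤ b) (hcd : c ≤ d) :
    ∫ x in a..b, ∫ y in c..d, E (x, y) = ∫ y in c..d, ∫ x in a..b, E (x, y) := by
  refine intervalIntegral_intervalIntegral_swap (F := fun x y => E (x, y)) ?_
  rw [Set.uIoc_of_le hab, Set.uIoc_of_le hcd]
  exact integrableOn_rectangle hE .rfl .rfl

end Rectangle

/-! ### Correlations of periodic functions -/

lemma intervalIntegral_deriv_eq_zero {g g' : ℝ → ℝ} (hg : ∀ x, HasDerivAt g (g' x) x)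
    (hg' : Continuous g') {a b : ℝ} (h : g a = g b) : ∫ x in a..b, g' x = 0 := by
  rw [intervalIntegral.integral_eq_sub_of_hasDerivAt (fun x _ => hg x)
    (hg'.intervalIntegrable _ _), h, sub_self]

lemma intervalIntegral_periodic_comp_add {g : ℝ → ℝ} {T : ℝ} (hg : Function.Periodic g T) (a : ℝ) :
    ∫ x in (0 : ℝ)..T, g (x + a) = ∫ x in (0 : ℝ)..T, g x := by
  rw [intervalIntegral.integral_comp_add_right, zero_add, add_comm T,
    hg.intervalIntegral_add_eq a 0, zero_add]

lemma intervalIntegral_half_of_even {g : ℝ → ℝ} (hg : Continuous g)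
    (hper : Function.Periodic g (2 * π)) (heven : Function.Even g) :
    ∫ x in (0 : ℝ)..2 * π, g x = 2 * ∫ x in (0 : ℝ)..π, g x := by
  have hreflect : ∫ x in π..2 * π, g x = ∫ x in (0 : ℝ)..π, g x := by
    have h := intervalIntegral.integral_comp_sub_left (a := 0) (b := π) g (2 * π)
    rw [show 2 * π - π = π by ring, sub_zero] at h
    rw [← h]
    exact intervalIntegral.integral_congr fun x _ => by rw [hper.sub_eq', heven]
  rw [← intervalIntegral.integral_add_adjacent_intervals (hg.intervalIntegrable 0 π)
    (hg.intervalIntegrable π (2 * π)), hreflect, two_mul]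

/-- The correlation of two `2π`-periodic functions, as a function of the shift `τ`. -/
noncomputable def correlation (f g : ℝ → ℝ) (τ : ℝ) : ℝ :=
  ∫ φ in (0 : ℝ)..2 * π, f φ * g (φ + τ)

section Correlation

variable {f g f' g' : ℝ → ℝ}

lemma continuous_correlation (hf : Continuous f) (hg : Continuous g) :
    Continuous (correlation f g) :=
  intervalIntegral.continuous_parametric_intervalIntegral_of_continuous'
    (f := fun τ φ => f φ * g (φ + τ)) (by fun_prop) 0 (2 * π)

lemma hasDerivAt_correlation (hf : Continuous f) (hg : ∀ x, HasDerivAt g (g' x) x)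
    (hg' : Continuous g') (τ : ℝ) : HasDerivAt (correlation f g) (correlation f g' τ) τ := by
  have hgc : Continuous g := continuous_iff_continuousAt.2 fun x => (hg x).continuousAt
  obtain ⟨C, hC⟩ := (isCompact_uIcc.prod (isCompact_closedBall τ 1)).exists_bound_of_continuousOn
    (f := fun x : ℝ × ℝ => f x.1 * g' (x.1 + x.2)) (s := Set.uIcc 0 (2 * π) ×ˢ _)
    (by fun_prop)
  refine (intervalIntegral.hasDerivAt_integral_of_dominated_loc_of_deriv_le
    (F := fun τ φ => f φ * g (φ + τ)) (F' := fun τ φ => f φ * g' (φ + τ)) (bound := fun _ => C)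
    (Metric.ball_mem_nhds τ one_pos) (.of_forall fun t => Continuous.aestronglyMeasurable ?_)
    (Continuous.intervalIntegrable ?_ _ _) (Continuous.aestronglyMeasurable ?_)
    (.of_forall fun φ hφ t ht => hC (φ, t)
      ⟨Set.uIoc_subset_uIcc hφ, Metric.ball_subset_closedBall ht⟩)
    intervalIntegrable_const (.of_forall fun φ _ t _ => ?_)).2
  · fun_prop
  · fun_prop
  · fun_prop
  · exact ((hg (φ + t)).comp_const_add φ t).const_mul (f φ)

lemma correlation_neg (hf : Function.Periodic f (2 * π)) (hg : Function.Periodic g (2 * π))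
    (τ : ℝ) : correlation f g (-τ) = correlation g f τ := by
  have hper : Function.Periodic (fun φ => f φ * g (φ + -τ)) (2 * π) := fun φ => by
    simp only [hf φ, add_right_comm φ, hg (φ + -τ)]
  rw [correlation, ← intervalIntegral_periodic_comp_add hper τ, correlation]
  exact intervalIntegral.integral_congr fun φ _ => by simp [mul_comm]

lemma correlation_even (hf : Function.Periodic f (2 * π)) : Function.Even (correlation f f) :=
  correlation_neg hf hf

lemma correlation_periodic (hg : Function.Periodic g (2 * π)) :
    Function.Periodic (correlation f g) (2 * π) := fun τ => by
  simp only [correlation, ← add_assoc, hg (_ + τ)]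

lemma correlation_deriv_left (hf : ∀ x, HasDerivAt f (f' x) x) (hf' : Continuous f')
    (hg : ∀ x, HasDerivAt g (g' x) x) (hg' : Continuous g') (hfper : Function.Periodic f (2 * π))
    (hgper : Function.Periodic g (2 * π)) (τ : ℝ) :
    correlation f' g τ = -correlation f g' τ := by
  have hparts := intervalIntegral.integral_mul_deriv_eq_deriv_mul (a := 0) (b := 2 * π)
    (fun x _ => hf x) (fun x _ => (hg (x + τ)).comp_add_const x τ) (hf'.intervalIntegrable _ _)
    (Continuous.intervalIntegrable (by fun_prop) _ _)
  have hf0 : f (2 * π) = f 0 := hfper.eq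
  have hg0 : g (2 * π + τ) = g (0 + τ) := by rw [add_comm, hgper, zero_add]
  rw [hf0, hg0, sub_self, zero_sub] at hparts
  rw [correlation, correlation, hparts, neg_neg]

lemma correlation_zero_deriv (hf : ∀ x, HasDerivAt f (f' x) x) (hf' : Continuous f')
    (hfper : Function.Periodic f (2 * π)) : correlation f f' 0 = 0 := by
  have h := correlation_deriv_left hf hf' hf hf' hfper hfper 0
  have hcomm : correlation f' f 0 = correlation f f' 0 := by simp [correlation, mul_comm]
  linarith

end Correlation

section CorrelationFourier

variable {f : ℝ → ℝ}

lemma integral_comp_add_mul_cos (hf : Continuous f) (hper : Function.Periodic f (2 * π)) (n : ℕ)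
    (φ : ℝ) : ∫ τ in (0 : ℝ)..2 * π, f (φ + τ) * cos (n * τ) =
      cos (n * φ) * (∫ ψ in (0 : ℝ)..2 * π, f ψ * cos (n * ψ)) +
        sin (n * φ) * ∫ ψ in (0 : ℝ)..2 * π, f ψ * sin (n * ψ) := by
  have hcosper : Function.Periodic (fun ψ => f ψ * cos (n * (ψ - φ))) (2 * π) := fun ψ => by
    simp only [hper ψ, show n * (ψ + 2 * π - φ) = n * (ψ - φ) + n * (2 * π) by ring,
      cos_add_nat_mul_two_pi]
  calc ∫ τ in (0 : ℝ)..2 * π, f (φ + τ) * cos (n * τ)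
      = ∫ τ in (0 : ℝ)..2 * π, f (τ + φ) * cos (n * (τ + φ - φ)) := by
        simp only [add_sub_cancel_right, add_comm φ]
    _ = ∫ ψ in (0 : ℝ)..2 * π, f ψ * cos (n * (ψ - φ)) :=
        intervalIntegral_periodic_comp_add hcosper φ
    _ = ∫ ψ in (0 : ℝ)..2 * π,
          (cos (n * φ) * (f ψ * cos (n * ψ)) + sin (n * φ) * (f ψ * sin (n * ψ))) := by
        simp only [mul_sub (n : ℝ), cos_sub]
        congr 1 with ψ
        ring
    _ = _ := by
        rw [intervalIntegral.integral_add, intervalIntegral.integral_const_mul,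
          intervalIntegral.integral_const_mul] <;>
        exact Continuous.intervalIntegrable (by fun_prop) _ _

lemma integral_correlation_mul_cos (hf : Continuous f) (hper : Function.Periodic f (2 * π))
    (n : ℕ) : ∫ τ in (0 : ℝ)..2 * π, correlation f f τ * cos (n * τ) =
      (∫ φ in (0 : ℝ)..2 * π, f φ * cos (n * φ)) ^ 2 +
        (∫ φ in (0 : ℝ)..2 * π, f φ * sin (n * φ)) ^ 2 := by
  set C := ∫ φ in (0 : ℝ)..2 * π, f φ * cos (n * φ) with hC
  set S := ∫ φ in (0 : ℝ)..2 * π, f φ * sin (n * φ) with hS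
  calc ∫ τ in (0 : ℝ)..2 * π, correlation f f τ * cos (n * τ)
      = ∫ τ in (0 : ℝ)..2 * π, ∫ φ in (0 : ℝ)..2 * π, f φ * f (φ + τ) * cos (n * τ) := by
        simp only [correlation, intervalIntegral.integral_mul_const]
    _ = ∫ φ in (0 : ℝ)..2 * π, ∫ τ in (0 : ℝ)..2 * π, f φ * f (φ + τ) * cos (n * τ) :=
        (integral_swap_of_continuous (E := fun x => f x.1 * f (x.1 + x.2) * cos (n * x.2))
          (by fun_prop) two_pi_pos.le two_pi_pos.le).symm
    _ = ∫ φ in (0 : ℝ)..2 * π, (C * (f φ * cos (n * φ)) + S * (f φ * sin (n * φ))) := by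
        simp only [mul_assoc, intervalIntegral.integral_const_mul,
          integral_comp_add_mul_cos hf hper, ← hC, ← hS]
        congr 1 with φ
        ring
    _ = C ^ 2 + S ^ 2 := by
        rw [intervalIntegral.integral_add, intervalIntegral.integral_const_mul,
          intervalIntegral.integral_const_mul, ← hC, ← hS, sq, sq] <;>
        exact Continuous.intervalIntegrable (by fun_prop) _ _

end CorrelationFourier

/-! ### The product of the two tangent lengths -/

/-- The product `sin² τ · tangentLeft f φ τ · tangentRight f φ τ`, with the division by `sin τ`
cleared. -/
noncomputable def tangentProduct (f : ℝ → ℝ) (x : ℝ × ℝ) : ℝ :=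
  (f (x.1 + x.2) - f x.1 * cos x.2 - deriv f x.1 * sin x.2) *
    (f x.1 - f (x.1 + x.2) * cos x.2 + deriv f (x.1 + x.2) * sin x.2)

lemma tangentProduct_eq (f : ℝ → ℝ) (φ : ℝ) {τ : ℝ} (hτ : sin τ ≠ 0) :
    tangentProduct f (φ, τ) = sin τ ^ 2 * (tangentLeft f φ τ * tangentRight f φ τ) := by
  rw [tangentProduct, tangentLeft_eq, tangentRight_eq]
  field_simp

section TangentProduct

variable {f : ℝ → ℝ} (hf : ContDiff ℝ 2 f) (hper : Function.Periodic f (2 * π))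
include hf

lemma continuous_tangentProduct : Continuous (tangentProduct f) := by
  have hf₀ := hf.continuous
  have hf₁ := hf.continuous_deriv one_le_two
  unfold tangentProduct
  fun_prop

include hper

lemma integral_tangentProduct_fst (τ : ℝ) :
    ∫ φ in (0 : ℝ)..2 * π, tangentProduct f (φ, τ) =
      (1 + cos τ ^ 2) * correlation f f τ - 2 * cos τ * correlation f f 0 -
        2 * (sin τ * cos τ) * correlation f (deriv f) τ +
        sin τ ^ 2 * correlation f (deriv (deriv f)) τ := by
  have hderiv (x : ℝ) : HasDerivAt f (deriv f x) x :=
    (hf.differentiable two_ne_zero x).hasDerivAt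
  have hderiv₂ (x : ℝ) : HasDerivAt (deriv f) (deriv (deriv f) x) x :=
    (hf.differentiable_deriv_two x).hasDerivAt
  have hf₀ := hf.continuous
  have hf₁ := hf.continuous_deriv one_le_two
  have hf₂ := continuous_deriv_deriv hf
  have hper₁ := periodic_deriv hper
  have hexpand (φ : ℝ) : tangentProduct f (φ, τ) = (1 + cos τ ^ 2) * (f φ * f (φ + τ)) -
      sin τ * cos τ * (f φ * deriv f (φ + τ)) + sin τ * cos τ * (deriv f φ * f (φ + τ)) -
      sin τ ^ 2 * (deriv f φ * deriv f (φ + τ)) - cos τ * (f φ * f φ) - sin τ * (f φ * deriv f φ) -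
      cos τ * (f (φ + τ) * f (φ + τ)) + sin τ * (f (φ + τ) * deriv f (φ + τ)) := by
    rw [tangentProduct]
    ring
  have hshift := intervalIntegral_periodic_comp_add (hper.mul hper) τ
  have hshift₁ := intervalIntegral_periodic_comp_add (hper.mul hper₁) τ
  have hzero := correlation_zero_deriv hderiv hf₁ hper
  have hparts := correlation_deriv_left hderiv hf₁ hderiv hf₁ hper hper τ
  have hparts₁ := correlation_deriv_left hderiv hf₁ hderiv₂ hf₂ hper hper₁ τ
  simp only [Pi.mul_apply] at hshift hshift₁
  simp only [correlation, add_zero] at hzero hparts hparts₁ ⊢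
  simp only [hexpand]
  rw [intervalIntegral.integral_add, intervalIntegral.integral_sub, intervalIntegral.integral_sub,
    intervalIntegral.integral_sub, intervalIntegral.integral_sub, intervalIntegral.integral_add,
    intervalIntegral.integral_sub]
  · simp only [intervalIntegral.integral_const_mul, hparts, hparts₁, hshift, hshift₁, hzero]
    ring
  all_goals exact Continuous.intervalIntegrable (by fun_prop) _ _

/-- Integrating `sin² · R'' - 2 sin cos · R'` by parts twice turns the integrand into the
autocorrelation `R` against a trigonometric kernel. -/
lemma integral_integral_tangentProduct :
    ∫ τ in (0 : ℝ)..π, ∫ φ in (0 : ℝ)..2 * π, tangentProduct f (φ, τ) =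
      ∫ τ in (0 : ℝ)..π, correlation f f τ * (3 / 2 + 9 / 2 * cos (2 * τ)) := by
  have hf₀ := hf.continuous
  have hf₁ := hf.continuous_deriv one_le_two
  have hf₂ := continuous_deriv_deriv hf
  have hR₀ := continuous_correlation hf₀ hf₀
  have hR₁ := continuous_correlation hf₀ hf₁
  have hR₂ := continuous_correlation hf₀ hf₂
  have hR : ∀ τ, HasDerivAt (correlation f f) (correlation f (deriv f) τ) τ :=
    hasDerivAt_correlation hf₀ (fun x => (hf.differentiable two_ne_zero x).hasDerivAt) hf₁
  have hR' : ∀ τ, HasDerivAt (correlation f (deriv f)) (correlation f (deriv (deriv f)) τ) τ :=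
    hasDerivAt_correlation hf₀ (fun x => (hf.differentiable_deriv_two x).hasDerivAt) hf₂
  rw [← sub_eq_zero, ← intervalIntegral.integral_sub]
  · refine intervalIntegral_deriv_eq_zero (g := fun τ => sin τ ^ 2 * correlation f (deriv f) τ -
      4 * (sin τ * cos τ) * correlation f f τ - sin τ * (2 * correlation f f 0))
      (fun τ => ?_) ?_ (by simp)
    · have hsin := hasDerivAt_sin τ
      have hcos := hasDerivAt_cos τ
      refine ((((hsin.pow 2).mul (hR' τ)).sub (((hsin.mul hcos).const_mul 4).mul (hR τ))).sub
        (hsin.mul_const _)).congr_deriv ?_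
      rw [integral_tangentProduct_fst hf hper, cos_two_mul]
      simp only [Pi.mul_apply, Pi.pow_apply]
      push_cast
      linear_combination 4 * correlation f f τ * sin_sq_add_cos_sq τ
    · simp only [integral_tangentProduct_fst hf hper]
      fun_prop
  · simp only [integral_tangentProduct_fst hf hper]
    exact Continuous.intervalIntegrable (by fun_prop) _ _
  · exact Continuous.intervalIntegrable (by fun_prop) _ _

lemma integral_tangentProduct : ∫ φ in (0 : ℝ)..2 * π, ∫ τ in (0 : ℝ)..π, tangentProduct f (φ, τ) =
    3 / 4 * (∫ φ in (0 : ℝ)..2 * π, f φ) ^ 2 +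
      9 / 4 * ((∫ φ in (0 : ℝ)..2 * π, f φ * cos (2 * φ)) ^ 2 +
        (∫ φ in (0 : ℝ)..2 * π, f φ * sin (2 * φ)) ^ 2) := by
  have hR := continuous_correlation hf.continuous hf.continuous
  have hhalf : ∫ τ in (0 : ℝ)..2 * π, correlation f f τ * (3 / 2 + 9 / 2 * cos (2 * τ)) =
      2 * ∫ τ in (0 : ℝ)..π, correlation f f τ * (3 / 2 + 9 / 2 * cos (2 * τ)) := by
    refine intervalIntegral_half_of_even (by fun_prop) (fun τ => ?_) fun τ => ?_
    · have hcos : cos (2 * (τ + 2 * π)) = cos (2 * τ) := by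
        simpa [mul_add] using cos_add_nat_mul_two_pi (2 * τ) 2
      simp only [correlation_periodic hper τ, hcos]
    · simp only [correlation_even hper τ, mul_neg, cos_neg]
  have hsplit : ∫ τ in (0 : ℝ)..2 * π, correlation f f τ * (3 / 2 + 9 / 2 * cos (2 * τ)) =
      3 / 2 * (∫ τ in (0 : ℝ)..2 * π, correlation f f τ * cos ((0 : ℕ) * τ)) +
        9 / 2 * ∫ τ in (0 : ℝ)..2 * π, correlation f f τ * cos ((2 : ℕ) * τ) := by
    rw [← intervalIntegral.integral_const_mul, ← intervalIntegral.integral_const_mul,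
      ← intervalIntegral.integral_add]
    · congr 1 with τ
      simp
      ring
    all_goals exact Continuous.intervalIntegrable (by fun_prop) _ _
  rw [integral_correlation_mul_cos hf.continuous hper,
    integral_correlation_mul_cos hf.continuous hper] at hsplit
  rw [integral_swap_of_continuous (continuous_tangentProduct hf) two_pi_pos.le pi_pos.le,
    integral_integral_tangentProduct hf hper]
  simp only [Nat.cast_zero, zero_mul, cos_zero, sin_zero, mul_one, mul_zero,
    intervalIntegral.integral_zero, Nat.cast_ofNat] at hsplit
  linarith

end TangentProduct

/-! ### The integral of `sin³ ω` -/

lemma cross_smul_N_add_smul_N' (a b c φ : ℝ) :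
    cross (a • N φ + b • N' φ) (c • N' φ) = a * c := by
  simp only [cross, PiLp.add_apply, PiLp.smul_apply, N_zero, N_one, N'_zero, N'_one, smul_eq_mul]
  linear_combination (a * c) * sin_sq_add_cos_sq φ

lemma hasFDerivAt_smul_N_add_smul_N' {f : ℝ → ℝ} {f' φ τ : ℝ} {g : ℝ × ℝ → ℝ}
    {g' : ℝ × ℝ →L[ℝ] ℝ} (hf : HasDerivAt f f' φ) (hg : HasFDerivAt g g' (φ, τ)) :
    HasFDerivAt (fun x : ℝ × ℝ => f x.1 • N x.1 + g x • N' x.1)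
      (columns ((f' - g (φ, τ)) • N φ + (f φ + g' (1, 0)) • N' φ) (g' (0, 1) • N' φ)) (φ, τ) := by
  have hfst : HasFDerivAt Prod.fst (ContinuousLinearMap.fst ℝ ℝ ℝ) (φ, τ) := hasFDerivAt_fst
  have hfN := (hf.smul (hasDerivAt_N φ)).hasFDerivAt.comp (φ, τ) hfst
  have hN' := (hasDerivAt_N' φ).hasFDerivAt.comp (φ, τ) hfst
  refine (hfN.add (hg.smul hN')).congr_fderiv (ContinuousLinearMap.ext fun x => ?_)
  have hx : g' x = x.1 * g' (1, 0) + x.2 * g' (0, 1) := by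
    rw [← smul_eq_mul, ← smul_eq_mul, ← map_smul, ← map_smul, ← map_add]
    simp
  simp only [Function.comp_apply, add_apply, ContinuousLinearMap.comp_apply,
    ContinuousLinearMap.coe_fst', ContinuousLinearMap.toSpanSingleton_apply, smul_add, smul_apply,
    smul_neg, ContinuousLinearMap.smulRight_apply, hx, columns_apply]
  module

lemma corner_eq (f : ℝ → ℝ) (x : ℝ × ℝ) : corner f x =
    f x.1 • N x.1 + (deriv f x.1 + tangentLeft f x.1 x.2) • N' x.1 := by
  rw [corner, envelope]
  module

lemma hasDerivAt_tangentLeft {f : ℝ → ℝ} (hf : Differentiable ℝ f) (φ : ℝ) {τ : ℝ}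
    (hτ : sin τ ≠ 0) :
    HasDerivAt (fun τ => tangentLeft f φ τ) (tangentRight f φ τ / sin τ) τ := by
  have hshift : HasDerivAt (fun τ => f (φ + τ)) (deriv f (φ + τ)) τ :=
    (hf (φ + τ)).hasDerivAt.comp_const_add φ τ
  simp only [tangentLeft_eq]
  refine (((hshift.sub ((hasDerivAt_cos τ).const_mul _)).sub
    ((hasDerivAt_sin τ).const_mul _)).div (hasDerivAt_sin τ) hτ).congr_deriv ?_
  rw [tangentRight_eq]
  simp only [Pi.sub_apply]
  field_simp
  linear_combination f φ * sin_sq_add_cos_sq τ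

lemma exists_hasFDerivAt_corner {f : ℝ → ℝ} (hf : ContDiff ℝ 2 f) (φ : ℝ) {τ : ℝ}
    (hτ : sin τ ≠ 0) : ∃ b : ℝ, HasFDerivAt (corner f)
      (columns (-tangentLeft f φ τ • N φ + b • N' φ) ((tangentRight f φ τ / sin τ) • N' φ))
      (φ, τ) := by
  have hf₀ := hf.differentiable two_ne_zero
  have := hf.differentiable_deriv_two
  set g : ℝ × ℝ → ℝ := fun x => deriv f x.1 + tangentLeft f x.1 x.2 with hg
  have hdiff : DifferentiableAt ℝ g (φ, τ) := by
    simp only [hg, tangentLeft_eq]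
    fun_prop (disch := exact hτ)
  have hpartial : fderiv ℝ g (φ, τ) (0, 1) = tangentRight f φ τ / sin τ := by
    have hline := hdiff.hasFDerivAt.comp_hasDerivAt τ
      ((hasDerivAt_const τ φ).prodMk (hasDerivAt_id τ))
    have hg' : HasDerivAt (fun τ => g (φ, τ)) (tangentRight f φ τ / sin τ) τ :=
      (hasDerivAt_tangentLeft hf₀ φ hτ).const_add (deriv f φ)
    exact hline.unique hg'
  have hcorner := hasFDerivAt_smul_N_add_smul_N' (hf₀ φ).hasDerivAt hdiff.hasFDerivAt
  rw [hpartial, show deriv f φ - g (φ, τ) = -tangentLeft f φ τ by simp [hg]] at hcorner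
  exact ⟨_, hcorner.congr_of_eventuallyEq (.of_forall (corner_eq f))⟩

lemma IsSmoothSupport.exists_jacobian_corner {f : ℝ → ℝ} (hf : IsSmoothSupport f) :
    ∃ u v : ℝ × ℝ → Plane, ∀ x ∈ cornerDomain,
      HasFDerivWithinAt (corner f) (columns (u x) (v x)) cornerDomain x ∧
        |cross (u x) (v x)| * sin x.2 ^ 3 = tangentProduct f x := by
  have hex (x : ℝ × ℝ) : ∃ uv : Plane × Plane, x ∈ cornerDomain →
      HasFDerivWithinAt (corner f) (columns uv.1 uv.2) cornerDomain x ∧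
        |cross uv.1 uv.2| * sin x.2 ^ 3 = tangentProduct f x := by
    by_cases hx : x ∈ cornerDomain
    swap
    · exact ⟨0, fun h => absurd h hx⟩
    obtain ⟨φ, τ⟩ := x
    have hτ : τ ∈ Set.Ioo 0 π := hx.2
    have hsin := sin_pos_of_mem_Ioo hτ
    obtain ⟨b, hb⟩ := exists_hasFDerivAt_corner hf.contDiff φ hsin.ne'
    refine ⟨(_, _), fun _ => ⟨hb.hasFDerivWithinAt, ?_⟩⟩
    rw [cross_smul_N_add_smul_N', neg_mul, abs_neg, tangentProduct_eq f φ hsin.ne',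
      abs_of_pos (mul_pos (hf.tangentLeft_pos hτ) (div_pos (hf.tangentRight_pos hτ) hsin))]
    field_simp
  choose uv huv using hex
  exact ⟨fun x => (uv x).1, fun x => (uv x).2, huv⟩

namespace IsSmoothBody

variable {K : Set Plane} (hK : IsSmoothBody K)
include hK

lemma exists_parametrization_compl : ∃ u v : ℝ × ℝ → Plane,
    (∀ x ∈ cornerDomain,
      HasFDerivWithinAt (corner (supp K)) (columns (u x) (v x)) cornerDomain x) ∧
    cornerDomain.EqOn (fun x => |cross (u x) (v x)| *
      sin (visualAngle K (corner (supp K) x)) ^ 3) (tangentProduct (supp K)) := by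
  obtain ⟨u, v, huv⟩ := hK.isSmoothSupport.exists_jacobian_corner
  refine ⟨u, v, fun x hx => (huv x hx).1, fun x hx => ?_⟩
  simp only [hK.visualAngle_corner x.1 hx.2, sin_pi_sub, (huv x hx).2]

lemma integrableOn_sin_visualAngle_cubed :
    IntegrableOn (fun P => sin (visualAngle K P) ^ 3) Kᶜ := by
  obtain ⟨u, v, hderiv, heq⟩ := hK.exists_parametrization_compl
  rw [← hK.image_corner, integrableOn_image_iff measurableSet_cornerDomain hderiv
    hK.isSmoothSupport.injOn_corner]
  exact (integrableOn_rectangle (continuous_tangentProduct hK.isSmoothSupport.contDiff)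
    Ico_ae_eq_Ioc Ioo_ae_eq_Ioc).congr_fun heq.symm measurableSet_cornerDomain

lemma integral_sin_visualAngle_cubed : ∫ P in Kᶜ, sin (visualAngle K P) ^ 3 =
    3 / 4 * (∫ φ in (0 : ℝ)..2 * π, supp K φ) ^ 2 +
      9 / 4 * ((∫ φ in (0 : ℝ)..2 * π, supp K φ * cos (2 * φ)) ^ 2 +
        (∫ φ in (0 : ℝ)..2 * π, supp K φ * sin (2 * φ)) ^ 2) := by
  have hf := hK.isSmoothSupport
  obtain ⟨u, v, hderiv, heq⟩ := hK.exists_parametrization_compl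
  rw [← hK.image_corner, setIntegral_image_eq measurableSet_cornerDomain hderiv hf.injOn_corner,
    setIntegral_congr_fun measurableSet_cornerDomain heq]
  exact (setIntegral_rectangle (continuous_tangentProduct hf.contDiff) two_pi_pos.le pi_pos.le
    Ico_ae_eq_Ioc Ioo_ae_eq_Ioc).trans (integral_tangentProduct hf.contDiff hf.periodic)

end IsSmoothBody

/-! ### Areas of star-shaped regions -/

/-- The parameters `(φ, t)` of the points of a star-shaped region other than its centre: `φ` is
the parameter of the boundary curve, `t` the fraction of the way from the centre to the curve. -/
def starDomain : Set (ℝ × ℝ) := Set.Ico 0 (2 * π) ×ˢ Set.Ioc 0 1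

lemma measurableSet_starDomain : MeasurableSet starDomain :=
  measurableSet_Ico.prod measurableSet_Ioc

lemma volume_real_star {β β' : ℝ → Plane} (c : Plane) (hβ : ∀ φ, HasDerivAt β (β' φ) φ)
    (hβ' : Continuous β') (hcross : ∀ φ, 0 ≤ cross (β φ) (β' φ))
    (hinj : starDomain.InjOn fun x => c + x.2 • β x.1) :
    volume.real (insert c ((fun x => c + x.2 • β x.1) '' starDomain)) =
      1 / 2 * ∫ φ in (0 : ℝ)..2 * π, cross (β φ) (β' φ) := by
  have hβc : Continuous β := continuous_iff_continuousAt.2 fun φ => (hβ φ).continuousAt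
  have hcont : Continuous fun x : ℝ × ℝ => x.2 * cross (β x.1) (β' x.1) := by
    simp only [cross]
    fun_prop
  have hderiv : ∀ x ∈ starDomain, HasFDerivWithinAt (fun x : ℝ × ℝ => c + x.2 • β x.1)
      (columns (x.2 • β' x.1) (β x.1)) starDomain x := by
    intro x _
    have hfst := (hβ x.1).hasFDerivAt.comp x hasFDerivAt_fst
    refine (((hasFDerivAt_snd.smul hfst).const_add c).congr_fderiv
      (ContinuousLinearMap.ext fun y => ?_)).hasFDerivWithinAt
    simp [columns_apply, smul_smul, mul_comm]
  have hjac : starDomain.EqOn (fun x => |cross (x.2 • β' x.1) (β x.1)| * 1)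
      fun x => x.2 * cross (β x.1) (β' x.1) := by
    rintro ⟨φ, t⟩ ⟨-, ht⟩
    have hswap : cross (t • β' φ) (β φ) = -(t * cross (β φ) (β' φ)) := by
      simp only [cross, PiLp.smul_apply, smul_eq_mul]
      ring
    simp only [hswap, abs_neg, mul_one]
    exact abs_of_nonneg (mul_nonneg ht.1.le (hcross φ))
  calc volume.real (insert c ((fun x => c + x.2 • β x.1) '' starDomain))
      = ∫ _ in (fun x : ℝ × ℝ => c + x.2 • β x.1) '' starDomain, (1 : ℝ) := by
        rw [measureReal_congr (insert_ae_eq_self _ _)]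
        simp
    _ = ∫ x in starDomain, x.2 * cross (β x.1) (β' x.1) := by
        rw [setIntegral_image_eq measurableSet_starDomain hderiv hinj,
          setIntegral_congr_fun measurableSet_starDomain hjac]
    _ = ∫ φ in (0 : ℝ)..2 * π, ∫ t in (0 : ℝ)..1, t * cross (β φ) (β' φ) :=
        setIntegral_rectangle hcont two_pi_pos.le zero_le_one Ico_ae_eq_Ioc .rfl
    _ = 1 / 2 * ∫ φ in (0 : ℝ)..2 * π, cross (β φ) (β' φ) := by
        simp only [intervalIntegral.integral_mul_const, integral_id,
          intervalIntegral.integral_const_mul]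
        norm_num

lemma exists_mem_Ico_forall_le_of_periodic {F : ℝ → ℝ} {T : ℝ} (hF : Continuous F)
    (hper : Function.Periodic F T) (hT : 0 < T) : ∃ b ∈ Set.Ico 0 T, ∀ φ, F φ ≤ F b := by
  obtain ⟨a, -, ha⟩ := isCompact_Icc.exists_isMaxOn (Set.nonempty_Icc.2 hT.le) hF.continuousOn
  obtain ⟨b, hb, hab⟩ := hper.exists_mem_Ico₀ hT a
  refine ⟨b, hb, fun φ => ?_⟩
  obtain ⟨φ', hφ', heq⟩ := hper.exists_mem_Ico₀ hT φ
  rw [heq, ← hab]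
  exact ha (Set.Ico_subset_Icc_self hφ')

lemma exists_inner_N_pos {v : Plane} (hv : v ≠ 0) : ∃ θ, 0 < inner ℝ v (N θ) := by
  obtain ⟨θ, hθ⟩ := exists_eq_smul_N v
  refine ⟨θ, ?_⟩
  rw [hθ, real_inner_smul_left, inner_N_N, sub_self, cos_zero, mul_one]
  exact norm_pos_iff.2 hv

lemma eq_of_N_eq {φ ψ : ℝ} (hφ : φ ∈ Set.Ico 0 (2 * π)) (hψ : ψ ∈ Set.Ico 0 (2 * π))
    (h : N φ = N ψ) : φ = ψ := by
  have hcos : cos (ψ - φ) = 1 := by rw [← inner_N_N, h, inner_N_N, sub_self, cos_zero]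
  rw [cos_eq_one_iff_of_lt_of_lt (by linarith [hφ.2, hψ.1]) (by linarith [hφ.1, hψ.2])] at hcos
  linarith

section Center

variable {f : ℝ → ℝ} {c : Plane}

/-- The gauge of the body about `c`: its value `t` at `x` is the largest quotient of the distances
of `x` and of the support lines from `c`, and the point of the boundary on the ray from `c`
through `x` is the one whose support line attains the maximum. -/
lemma exists_add_smul_envelope_sub_eq (hf : Differentiable ℝ f)
    (hper : Function.Periodic f (2 * π)) (hc : ∀ ψ, inner ℝ c (N ψ) < f ψ) {x : Plane}
    (hx : ∀ ψ, inner ℝ x (N ψ) ≤ f ψ) (hxc : x ≠ c) :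
    ∃ y ∈ starDomain, c + y.2 • (envelope f y.1 - c) = x := by
  set F : ℝ → ℝ := fun φ => inner ℝ (x - c) (N φ) / (f φ - inner ℝ c (N φ)) with hF
  have hq (φ : ℝ) : 0 < f φ - inner ℝ c (N φ) := sub_pos.2 (hc φ)
  have hFc : Continuous F := by
    have := hf.continuous
    simp only [hF, inner_N]
    refine Continuous.div (by fun_prop) (by fun_prop) fun φ => ?_
    rw [← inner_N]
    exact (hq φ).ne'
  obtain ⟨b, hb, hmax⟩ := exists_mem_Ico_forall_le_of_periodic hFc
    (fun φ => by simp only [hF, N_periodic φ, hper φ]) two_pi_pos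
  have hpos : 0 < F b := by
    obtain ⟨θ, hθ⟩ := exists_inner_N_pos (sub_ne_zero.2 hxc)
    exact (div_pos hθ (hq θ)).trans_le (hmax θ)
  have hle : F b ≤ 1 := by
    rw [hF, div_le_one (hq b), inner_sub_left]
    linarith [hx b]
  have hinner (φ : ℝ) : inner ℝ (c + (F b)⁻¹ • (x - c)) (N φ) =
      inner ℝ c (N φ) + (F b)⁻¹ * inner ℝ (x - c) (N φ) := by
    rw [inner_add_left, real_inner_smul_left]
  have henv : c + (F b)⁻¹ • (x - c) = envelope f b := by
    refine eq_envelope_of_inner_le (hf b) (fun φ => ?_) ?_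
    · have hφ := (div_le_iff₀ (hq φ)).1 (hmax φ)
      rw [← inv_mul_le_iff₀ hpos] at hφ
      rw [hinner]
      linarith
    · rw [hinner, ← div_mul_cancel₀ (inner ℝ (x - c) (N b)) (hq b).ne',
        inv_mul_cancel_left₀ hpos.ne', add_sub_cancel]
  refine ⟨(b, F b), ⟨hb, hpos, hle⟩, ?_⟩
  simp only [← henv, add_sub_cancel_left, smul_inv_smul₀ hpos.ne', add_sub_cancel]

lemma IsSmoothSupport.eq_of_smul_envelope_sub_eq (hf : IsSmoothSupport f) {φ ψ s t : ℝ}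
    (hc : inner ℝ c (N ψ) < f ψ) (hφ : φ ∈ Set.Ico 0 (2 * π)) (hψ : ψ ∈ Set.Ico 0 (2 * π))
    (hs : 0 < s) (hst : s ≤ t) (h : s • (envelope f φ - c) = t • (envelope f ψ - c)) :
    φ = ψ ∧ s = t := by
  have hq := sub_pos.2 hc
  have hinner := congrArg (fun v => inner ℝ v (N ψ)) h
  simp only [real_inner_smul_left, inner_sub_left, inner_envelope_self] at hinner
  have hφψ : φ = ψ := by
    by_contra hne
    have hlt : inner ℝ (envelope f φ) (N ψ) < f ψ := by
      rcases lt_or_gt_of_ne hne with hlt | hlt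
      · exact hf.inner_envelope_lt hlt (by linarith [hφ.1, hψ.2])
      · rw [← N_periodic, ← hf.periodic]
        exact hf.inner_envelope_lt (by linarith [hφ.2, hψ.1]) (by linarith)
    nlinarith
  subst hφψ
  rw [inner_envelope_self] at hinner
  exact ⟨rfl, mul_right_cancel₀ hq.ne' hinner⟩

lemma IsSmoothSupport.injOn_add_smul_envelope_sub (hf : IsSmoothSupport f)
    (hc : ∀ ψ, inner ℝ c (N ψ) < f ψ) :
    starDomain.InjOn fun x => c + x.2 • (envelope f x.1 - c) := by
  rintro ⟨φ, s⟩ ⟨hφ, hs⟩ ⟨ψ, t⟩ ⟨hψ, ht⟩ h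
  have heq : s • (envelope f φ - c) = t • (envelope f ψ - c) := add_left_cancel h
  rcases le_total s t with hst | hts
  · obtain ⟨rfl, rfl⟩ := hf.eq_of_smul_envelope_sub_eq (hc ψ) hφ hψ hs.1 hst heq
    rfl
  · obtain ⟨rfl, rfl⟩ := hf.eq_of_smul_envelope_sub_eq (hc φ) hψ hφ ht.1 hts heq.symm
    rfl

lemma IsSmoothBody.eq_star {K : Set Plane} (hK : IsSmoothBody K)
    (hc : ∀ ψ, inner ℝ c (N ψ) < supp K ψ) :
    K = insert c ((fun x => c + x.2 • (boundary K x.1 - c)) '' starDomain) := by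
  have hcK : c ∈ K := hK.mem_iff.2 fun ψ => (hc ψ).le
  refine Set.Subset.antisymm (fun x hx => ?_) ?_
  · rw [Set.mem_insert_iff, or_iff_not_imp_left]
    exact exists_add_smul_envelope_sub_eq (hK.isSmoothSupport.contDiff.differentiable two_ne_zero)
      (supp_periodic K) hc (hK.mem_iff.1 hx)
  · rintro x (rfl | ⟨⟨φ, t⟩, ⟨-, ht⟩, rfl⟩)
    · exact hcK
    · exact hK.convex.add_smul_sub_mem hcK (hK.boundary_mem φ) ⟨ht.1.le, ht.2⟩

lemma IsSmoothBody.area_eq_of_inner_lt {K : Set Plane} (hK : IsSmoothBody K)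
    (hc : ∀ ψ, inner ℝ c (N ψ) < supp K ψ) : area K =
      1 / 2 * ∫ φ in (0 : ℝ)..2 * π, curvRadius K φ * (supp K φ - inner ℝ c (N φ)) := by
  have hf := hK.isSmoothSupport
  have hcross (φ : ℝ) : cross (boundary K φ - c) (curvRadius K φ • N' φ) =
      curvRadius K φ * (supp K φ - inner ℝ c (N φ)) := by
    rw [← inner_envelope_self (supp K) φ]
    simp only [cross, boundary, inner_N, PiLp.sub_apply, PiLp.smul_apply, N'_zero, N'_one,
      smul_eq_mul]
    ring
  have hN' := continuous_N'
  have hcont : Continuous fun φ => curvRadius K φ • N' φ :=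
    (hf.contDiff.continuous.add (continuous_deriv_deriv hf.contDiff)).smul hN'
  have harea := volume_real_star c
    (fun φ => (hasDerivAt_envelope hf.contDiff φ).sub_const c) hcont
    (fun φ => (hcross φ).symm ▸ mul_nonneg (hf.curvRadius_pos φ).le (sub_pos.2 (hc φ)).le)
    (hf.injOn_add_smul_envelope_sub hc)
  conv_lhs => rw [area, hK.eq_star hc]
  exact harea.trans (by simp only [← hcross]; rfl)

end Center

/-! ### The Steiner point and the pedal curve -/

lemma integral_inner_envelope {f : ℝ → ℝ} (hf : ContDiff ℝ 2 f)
    (hper : Function.Periodic f (2 * π)) (ψ : ℝ) :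
    ∫ φ in (0 : ℝ)..2 * π, inner ℝ (envelope f φ) (N ψ) =
      2 * ∫ φ in (0 : ℝ)..2 * π, f φ * cos (ψ - φ) := by
  have hf₀ := hf.continuous
  have hf₁ := hf.continuous_deriv one_le_two
  have hparts : ∫ φ in (0 : ℝ)..2 * π, (deriv f φ * sin (ψ - φ) - f φ * cos (ψ - φ)) = 0 := by
    refine intervalIntegral_deriv_eq_zero (g := fun φ => f φ * sin (ψ - φ)) (fun φ => ?_)
      (by fun_prop) (by simp [hper.eq])
    refine ((hf.differentiable two_ne_zero φ).hasDerivAt.mul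
      ((hasDerivAt_id φ).const_sub ψ).sin).congr_deriv ?_
    simp only [id_eq]
    ring
  rw [intervalIntegral.integral_sub, sub_eq_zero] at hparts
  · simp only [inner_envelope]
    rw [intervalIntegral.integral_add, hparts, ← two_mul]
    all_goals exact Continuous.intervalIntegrable (by fun_prop) _ _
  all_goals exact Continuous.intervalIntegrable (by fun_prop) _ _

lemma IsSmoothSupport.integral_mul_cos_lt {f : ℝ → ℝ} (hf : IsSmoothSupport f) (ψ : ℝ) :
    ∫ φ in (0 : ℝ)..2 * π, f φ * cos (ψ - φ) < π * f ψ := by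
  have hf₀ := hf.contDiff.continuous
  have hf₁ := hf.contDiff.continuous_deriv one_le_two
  have hcont : Continuous fun φ => inner ℝ (envelope f φ) (N ψ) := by
    simp only [inner_envelope]
    fun_prop
  have hper : Function.Periodic (fun φ => inner ℝ (envelope f φ) (N ψ)) (2 * π) := fun φ => by
    simp only [envelope_periodic hf.periodic φ]
  have hlt : ∫ φ in (0 : ℝ)..2 * π, inner ℝ (envelope f (φ + ψ)) (N ψ) <
      ∫ _ in (0 : ℝ)..2 * π, f ψ := by
    refine intervalIntegral.integral_lt_integral_of_continuousOn_of_le_of_exists_lt two_pi_pos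
      (hcont.comp (continuous_add_const ψ)).continuousOn continuousOn_const
      (fun φ _ => hf.inner_envelope_le _ _)
      ⟨π, ⟨pi_pos.le, by linarith [pi_pos]⟩, ?_⟩
    exact hf.inner_envelope_lt_of_le_pi (by simp [pi_ne_zero]) (by simp [abs_of_pos pi_pos])
  rw [intervalIntegral_periodic_comp_add hper ψ, integral_inner_envelope hf.contDiff hf.periodic,
    intervalIntegral.integral_const, smul_eq_mul] at hlt
  linarith

section SteinerPoint

variable {K : Set Plane} (hK : Continuous (supp K))
include hK

lemma inner_steinerPoint (x : Plane) : inner ℝ x (steinerPoint K) =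
    1 / π * ∫ φ in (0 : ℝ)..2 * π, supp K φ * inner ℝ x (N φ) := by
  have hint : IntervalIntegrable (fun φ => supp K φ • N φ) volume 0 (2 * π) :=
    (hK.smul continuous_N).intervalIntegrable _ _
  have hcomm := (innerSL ℝ x).intervalIntegral_comp_comm hint
  simp only [innerSL_apply_apply, real_inner_smul_right] at hcomm
  rw [steinerPoint, real_inner_smul_right, hcomm]

lemma steinerPoint_zero :
    steinerPoint K 0 = 1 / π * ∫ φ in (0 : ℝ)..2 * π, supp K φ * cos φ := by
  simpa [inner_eq] using inner_steinerPoint hK (N 0)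

lemma steinerPoint_one :
    steinerPoint K 1 = 1 / π * ∫ φ in (0 : ℝ)..2 * π, supp K φ * sin φ := by
  simpa [inner_eq] using inner_steinerPoint hK (N (π / 2))

end SteinerPoint

lemma integral_inner_N_sq (x : Plane) :
    ∫ φ in (0 : ℝ)..2 * π, (inner ℝ x (N φ) : ℝ) ^ 2 = π * inner ℝ x x := by
  have hexpand (φ : ℝ) : (inner ℝ x (N φ) : ℝ) ^ 2 =
      x 0 ^ 2 * cos φ ^ 2 + x 1 ^ 2 * sin φ ^ 2 + 2 * x 0 * x 1 * (sin φ * cos φ) := by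
    rw [inner_N]
    ring
  simp only [hexpand]
  rw [intervalIntegral.integral_add, intervalIntegral.integral_add]
  · simp only [intervalIntegral.integral_const_mul, integral_cos_sq, integral_sin_sq,
      integral_sin_mul_cos₁, inner_eq]
    simp
    ring
  all_goals exact Continuous.intervalIntegrable (by fun_prop) _ _

lemma iUnion_segment_add_smul_N {q : ℝ → ℝ} (hq : Function.Periodic q (2 * π)) (c : Plane) :
    ⋃ φ, segment ℝ c (c + q φ • N φ) =
      insert c ((fun x => c + x.2 • (q x.1 • N x.1)) '' starDomain) := by
  ext x
  simp only [Set.mem_iUnion, segment_eq_image', Set.mem_insert_iff, Set.mem_image,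
    add_sub_cancel_left]
  constructor
  · rintro ⟨φ, t, ht, rfl⟩
    rcases eq_or_lt_of_le ht.1 with rfl | hpos
    · simp
    have hper : Function.Periodic (fun φ => q φ • N φ) (2 * π) := fun φ => by
      simp only [hq φ, N_periodic φ]
    obtain ⟨ψ, hψ, heq⟩ := hper.exists_mem_Ico₀ two_pi_pos φ
    exact .inr ⟨(ψ, t), ⟨hψ, hpos, ht.2⟩, by rw [heq]⟩
  · rintro (rfl | ⟨⟨φ, t⟩, ⟨-, ht⟩, rfl⟩)
    · exact ⟨0, 0, by simp, by simp⟩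
    · exact ⟨φ, t, ⟨ht.1.le, ht.2⟩, rfl⟩

lemma injOn_add_smul_smul_N {q : ℝ → ℝ} (hq : ∀ φ, 0 < q φ) (c : Plane) :
    starDomain.InjOn fun x => c + x.2 • (q x.1 • N x.1) := by
  rintro ⟨φ, s⟩ ⟨hφ, hs⟩ ⟨ψ, t⟩ ⟨hψ, ht⟩ h
  have heq : (s * q φ) • N φ = (t * q ψ) • N ψ := by
    simpa only [add_right_inj, smul_smul] using h
  have hsq : 0 < s * q φ := mul_pos hs.1 (hq φ)
  have htq : 0 < t * q ψ := mul_pos ht.1 (hq ψ)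
  have hnorm : s * q φ = t * q ψ := by
    simpa only [norm_smul, norm_N, mul_one, norm_of_nonneg hsq.le, norm_of_nonneg htq.le]
      using congrArg norm heq
  rw [hnorm] at heq
  obtain rfl : φ = ψ := eq_of_N_eq hφ hψ (smul_right_injective Plane htq.ne' heq)
  rw [mul_right_cancel₀ (hq φ).ne' hnorm]

lemma volume_real_iUnion_segment_add_smul_N {q : ℝ → ℝ} (hq : ContDiff ℝ 1 q)
    (hper : Function.Periodic q (2 * π)) (hpos : ∀ φ, 0 < q φ) (c : Plane) :
    volume.real (⋃ φ, segment ℝ c (c + q φ • N φ)) = 1 / 2 * ∫ φ in (0 : ℝ)..2 * π, q φ ^ 2 := by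
  have hN' := continuous_N'
  have hN := continuous_N
  have hq₀ := hq.continuous
  have := hq.continuous_deriv_one
  have hcross (φ : ℝ) : cross (q φ • N φ) (q φ • N' φ + deriv q φ • N φ) = q φ ^ 2 := by
    simp only [cross, PiLp.add_apply, PiLp.smul_apply, N_zero, N_one, N'_zero, N'_one, smul_eq_mul]
    linear_combination q φ ^ 2 * sin_sq_add_cos_sq φ
  rw [iUnion_segment_add_smul_N hper c, volume_real_star (β := fun φ => q φ • N φ) c
    (fun φ => (hq.differentiable_one φ).hasDerivAt.smul (hasDerivAt_N φ)) (by fun_prop)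
    (fun φ => (hcross φ).symm ▸ sq_nonneg _) (injOn_add_smul_smul_N hpos c)]
  simp only [hcross]

namespace IsSmoothBody

variable {K : Set Plane} (hK : IsSmoothBody K)
include hK

lemma inner_steinerPoint_lt (ψ : ℝ) : inner ℝ (steinerPoint K) (N ψ) < supp K ψ := by
  have hmean := hK.isSmoothSupport.integral_mul_cos_lt ψ
  rw [real_inner_comm, inner_steinerPoint hK.isSmoothSupport.contDiff.continuous, one_div,
    inv_mul_lt_iff₀ pi_pos]
  simpa only [inner_N_N, ← cos_neg (ψ - _), neg_sub] using hmean

lemma pedalArea_eq : pedalArea K = 1 / 2 * ((∫ φ in (0 : ℝ)..2 * π, supp K φ ^ 2) -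
    1 / π * ((∫ φ in (0 : ℝ)..2 * π, supp K φ * cos φ) ^ 2 +
      (∫ φ in (0 : ℝ)..2 * π, supp K φ * sin φ) ^ 2)) := by
  have hf := hK.isSmoothSupport
  have hcont := hf.contDiff.continuous
  set c := steinerPoint K with hc
  have hq := hf.sub_inner c
  have hmixed : ∫ φ in (0 : ℝ)..2 * π, supp K φ * inner ℝ c (N φ) = π * inner ℝ c c := by
    rw [hc, inner_steinerPoint hcont (steinerPoint K)]
    field_simp
  have hexpand (φ : ℝ) : (supp K φ - inner ℝ c (N φ)) ^ 2 =
      supp K φ ^ 2 - 2 * (supp K φ * inner ℝ c (N φ)) + inner ℝ c (N φ) ^ 2 := by ring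
  have hinner : Continuous fun φ => inner ℝ c (N φ) := by
    simp only [inner_N]
    fun_prop
  have harea := volume_real_iUnion_segment_add_smul_N (hq.contDiff.of_le one_le_two)
    hq.periodic (fun φ => sub_pos.2 (hK.inner_steinerPoint_lt φ)) c
  refine harea.trans ?_
  simp only [hexpand]
  rw [intervalIntegral.integral_add, intervalIntegral.integral_sub,
    intervalIntegral.integral_const_mul, hmixed, integral_inner_N_sq, inner_eq, hc,
    steinerPoint_zero hcont, steinerPoint_one hcont]
  · field_simp
    ring
  all_goals exact Continuous.intervalIntegrable (by fun_prop) _ _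

end IsSmoothBody

/-! ### Area and perimeter -/

lemma integral_curvRadius_mul_sub_inner {f : ℝ → ℝ} (hf : ContDiff ℝ 2 f)
    (hper : Function.Periodic f (2 * π)) (c : Plane) :
    ∫ φ in (0 : ℝ)..2 * π, (f φ + deriv (deriv f) φ) * (f φ - inner ℝ c (N φ)) =
      (∫ φ in (0 : ℝ)..2 * π, f φ ^ 2) - ∫ φ in (0 : ℝ)..2 * π, deriv f φ ^ 2 := by
  have hf₀ := hf.continuous
  have hf₁ := hf.continuous_deriv one_le_two
  have := continuous_deriv_deriv hf
  have hd₀ (φ : ℝ) := (hf.differentiable two_ne_zero φ).hasDerivAt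
  have hd₁ (φ : ℝ) := (hf.differentiable_deriv_two φ).hasDerivAt
  have hN (φ : ℝ) : HasDerivAt (fun φ => inner ℝ c (N φ)) (inner ℝ c (N' φ)) φ := by
    simpa using (hasDerivAt_const φ c).inner ℝ (hasDerivAt_N φ)
  have hN' (φ : ℝ) : HasDerivAt (fun φ => inner ℝ c (N' φ)) (-inner ℝ c (N φ)) φ := by
    simpa using (hasDerivAt_const φ c).inner ℝ (hasDerivAt_N' φ)
  have hcN : Continuous fun φ => inner ℝ c (N φ) :=
    continuous_iff_continuousAt.2 fun φ => (hN φ).continuousAt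
  have hparts : ∫ φ in (0 : ℝ)..2 * π, (f φ * deriv (deriv f) φ + deriv f φ ^ 2 -
      (f φ + deriv (deriv f) φ) * inner ℝ c (N φ)) = 0 := by
    refine intervalIntegral_deriv_eq_zero (g := fun φ => f φ * deriv f φ -
      (deriv f φ * inner ℝ c (N φ) - f φ * inner ℝ c (N' φ))) (fun φ => ?_) (by fun_prop) ?_
    · refine (((hd₀ φ).mul (hd₁ φ)).sub
        (((hd₁ φ).mul (hN φ)).sub ((hd₀ φ).mul (hN' φ)))).congr_deriv ?_
      ring
    · simp only [hper.eq, (periodic_deriv hper).eq, N_periodic.eq, N'_periodic.eq]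
  rw [← intervalIntegral.integral_sub, ← sub_eq_zero, ← intervalIntegral.integral_sub]
  · refine (intervalIntegral.integral_congr fun φ _ => ?_).trans hparts
    ring
  all_goals exact Continuous.intervalIntegrable (by fun_prop) _ _

namespace IsSmoothBody

variable {K : Set Plane} (hK : IsSmoothBody K)
include hK

lemma area_eq : area K = 1 / 2 * ((∫ φ in (0 : ℝ)..2 * π, supp K φ ^ 2) -
    ∫ φ in (0 : ℝ)..2 * π, deriv (supp K) φ ^ 2) := by
  rw [hK.area_eq_of_inner_lt hK.inner_steinerPoint_lt, ← integral_curvRadius_mul_sub_inner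
    hK.isSmoothSupport.contDiff (supp_periodic K) (steinerPoint K)]
  rfl

lemma norm_deriv_boundary (φ : ℝ) : ‖deriv (boundary K) φ‖ = curvRadius K φ := by
  have hf := hK.isSmoothSupport
  rw [boundary, (hasDerivAt_envelope hf.contDiff φ).deriv, norm_smul, norm_N', mul_one]
  exact norm_of_nonneg (hf.curvRadius_pos φ).le

lemma perimeter_eq : perimeter K = ∫ φ in (0 : ℝ)..2 * π, supp K φ := by
  have hf := hK.isSmoothSupport
  have hp₂ := continuous_deriv_deriv hf.contDiff
  simp only [perimeter, hK.norm_deriv_boundary, curvRadius]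
  rw [intervalIntegral.integral_add (hf.contDiff.continuous.intervalIntegrable _ _)
    (hp₂.intervalIntegrable _ _), intervalIntegral_deriv_eq_zero hf.hasDerivAt_deriv hp₂
    (periodic_deriv hf.periodic).eq.symm, add_zero]

lemma perimeter_pos : 0 < perimeter K := by
  have hf := hK.isSmoothSupport.contDiff
  simp only [perimeter, hK.norm_deriv_boundary]
  exact intervalIntegral.intervalIntegral_pos_of_pos
    ((hf.continuous.add (continuous_deriv_deriv hf)).intervalIntegrable _ _)
    hK.isSmoothSupport.curvRadius_pos two_pi_pos

end IsSmoothBody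

/-! ### The area swept by the evolute -/

lemma partition_mem_Icc {a b : ℝ} {n : ℕ} {t : ℕ → ℝ} (ha : t 0 = a) (hb : t n = b)
    (hstep : ∀ i < n, t i ≤ t (i + 1)) {i : ℕ} (hi : i ≤ n) : t i ∈ Set.Icc a b := by
  have hmono : MonotoneOn t (Set.Iic n) :=
    monotoneOn_of_le_succ Set.ordConnected_Iic fun j _ _ hj => hstep j (Nat.lt_of_succ_le hj)
  exact ⟨ha ▸ hmono (Nat.zero_le n) hi (Nat.zero_le i), hb ▸ hmono hi (Set.mem_Iic.2 le_rfl) hi⟩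

lemma exists_forall_abs_lt_of_diagonal_eq_zero {D : ℝ × ℝ × ℝ → ℝ} (hD : Continuous D)
    (hdiag : ∀ s, D (s, s, s) = 0) (a b : ℝ) {ε : ℝ} (hε : 0 < ε) :
    ∃ δ > 0, ∀ s t x, a ≤ s → s ≤ x → x ≤ t → t ≤ b → t - s < δ → |D (s, t, x)| < ε := by
  have hcompact := isCompact_Icc (a := a) (b := b)
  obtain ⟨δ, hδ, hunif⟩ := Metric.uniformContinuousOn_iff.1
    ((hcompact.prod (hcompact.prod hcompact)).uniformContinuousOn_of_continuous hD.continuousOn)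
    ε hε
  refine ⟨δ, hδ, fun s t x has hsx hxt htb hts => ?_⟩
  have hs : s ∈ Set.Icc a b := ⟨has, by linarith⟩
  have hdist := hunif (s, t, x) ⟨hs, ⟨by linarith, htb⟩, by linarith, by linarith⟩
    (s, s, s) ⟨hs, hs, hs⟩ (by
      simp only [Prod.dist_eq, dist_self, Real.dist_eq, abs_of_nonneg (sub_nonneg.2 hsx),
        abs_of_nonneg (sub_nonneg.2 (hsx.trans hxt))]
      exact max_lt hδ (max_lt hts (by linarith)))
  rwa [hdiag, dist_zero_right] at hdist

lemma hasSweptArea_of_cross_eq {c : ℝ → Plane} {g k : ℝ → ℝ} {D : ℝ × ℝ × ℝ → ℝ} {a b : ℝ}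
    (hcross : ∀ s t, cross (c s) (c t) =
      (g t - g s) + (∫ x in s..t, k x) + ∫ x in s..t, D (s, t, x))
    (hk : Continuous k) (hD : Continuous D) (hdiag : ∀ s, D (s, s, s) = 0) (hab : a < b)
    (hg : g a = g b) : HasSweptArea c a b (1 / 2 * ∫ x in a..b, k x) := by
  intro ε hε
  obtain ⟨δ, hδ, hsmall⟩ :=
    exists_forall_abs_lt_of_diagonal_eq_zero hD hdiag a b (div_pos hε (sub_pos.2 hab))
  refine ⟨δ, hδ, fun n t ha hb ht => ?_⟩
  have hmem {i : ℕ} (hi : i ≤ n) : t i ∈ Set.Icc a b :=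
    partition_mem_Icc ha hb (fun j hj => (ht j hj).1) hi
  have hcell : ∀ i ∈ Finset.range n, |∫ x in t i..t (i + 1), D (t i, t (i + 1), x)| ≤
      ε / (b - a) * (t (i + 1) - t i) := by
    intro i hi
    rw [Finset.mem_range] at hi
    obtain ⟨hle, hmesh⟩ := ht i hi
    rw [← norm_eq_abs, ← abs_of_nonneg (sub_nonneg.2 hle)]
    refine intervalIntegral.norm_integral_le_of_norm_le_const fun x hx => ?_
    rw [Set.uIoc_of_le hle] at hx
    exact (hsmall _ _ _ (hmem hi.le).1 hx.1.le hx.2 (hmem hi).2 hmesh).le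
  have herror : |∑ i ∈ Finset.range n, ∫ x in t i..t (i + 1), D (t i, t (i + 1), x)| ≤ ε := by
    refine (Finset.abs_sum_le_sum_abs _ _).trans ((Finset.sum_le_sum hcell).trans ?_)
    rw [← Finset.mul_sum, Finset.sum_range_sub, ha, hb, div_mul_cancel₀ _ (sub_pos.2 hab).ne']
  have hsum : ∑ i ∈ Finset.range n, cross (c (t i)) (c (t (i + 1))) = (∫ x in a..b, k x) +
      ∑ i ∈ Finset.range n, ∫ x in t i..t (i + 1), D (t i, t (i + 1), x) := by
    simp only [hcross, Finset.sum_add_distrib]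
    rw [Finset.sum_range_sub fun i => g (t i), ha, hb, hg, sub_self, zero_add,
      intervalIntegral.sum_integral_adjacent_intervals fun i _ => hk.intervalIntegrable _ _, ha, hb]
  rw [hsum, add_div, one_div_mul_eq_div, add_sub_cancel_left, abs_div, abs_two]
  linarith

-- The last integrand vanishes on the diagonal `s = t = x`, so its integrals do not contribute to
-- the limit.
lemma cross_smul_N'_sub_smul_N_eq {h h' : ℝ → ℝ} (hh : ∀ x, HasDerivAt h (h' x) x)
    (hc' : Continuous h') (s t : ℝ) :
    cross (h s • N' s - h' s • N s) (h t • N' t - h' t • N t) =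
      (h t * h' t - h s * h' s) + (∫ x in s..t, (h x ^ 2 - h' x ^ 2)) +
        ∫ x in s..t, ((h s * h t + h' s * h' t) * cos (x - s) -
          (h s * h' t - h' s * h t) * sin (x - s) - (h' t + h' s) * h' x -
          (h x ^ 2 - h' x ^ 2)) := by
  have hc : Continuous h := continuous_iff_continuousAt.2 fun x => (hh x).continuousAt
  have hprimitive (x : ℝ) : HasDerivAt (fun x => (h s * h t + h' s * h' t) * sin (x - s) +
      (h s * h' t - h' s * h t) * cos (x - s) - (h' t + h' s) * h x)
      ((h s * h t + h' s * h' t) * cos (x - s) - (h s * h' t - h' s * h t) * sin (x - s) -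
        (h' t + h' s) * h' x) x := by
    refine (((((hasDerivAt_sin (x - s)).comp_sub_const x s).const_mul _).add
      (((hasDerivAt_cos (x - s)).comp_sub_const x s).const_mul _)).sub
      ((hh x).const_mul _)).congr_deriv ?_
    ring
  rw [add_assoc, ← intervalIntegral.integral_add]
  · simp only [add_sub_cancel]
    rw [intervalIntegral.integral_eq_sub_of_hasDerivAt fun x _ => hprimitive x]
    · simp only [sub_self, sin_zero, cos_zero, cross, PiLp.sub_apply, PiLp.smul_apply, N_zero,
        N_one, N'_zero, N'_one, smul_eq_mul, sin_sub, cos_sub]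
      ring
    · exact Continuous.intervalIntegrable (by fun_prop) _ _
  all_goals exact Continuous.intervalIntegrable (by fun_prop) _ _

lemma hasSweptArea_smul_N'_sub_smul_N {h h' : ℝ → ℝ} (hh : ∀ x, HasDerivAt h (h' x) x)
    (hc' : Continuous h') {a b : ℝ} (hab : a < b) (hper : h a * h' a = h b * h' b) :
    HasSweptArea (fun φ => h φ • N' φ - h' φ • N φ) a b
      (1 / 2 * ((∫ x in a..b, h x ^ 2) - ∫ x in a..b, h' x ^ 2)) := by
  have hc : Continuous h := continuous_iff_continuousAt.2 fun x => (hh x).continuousAt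
  rw [← intervalIntegral.integral_sub]
  · refine hasSweptArea_of_cross_eq (D := fun y =>
      (h y.1 * h y.2.1 + h' y.1 * h' y.2.1) * cos (y.2.2 - y.1) -
      (h y.1 * h' y.2.1 - h' y.1 * h y.2.1) * sin (y.2.2 - y.1) -
      (h' y.2.1 + h' y.1) * h' y.2.2 - (h y.2.2 ^ 2 - h' y.2.2 ^ 2))
      (cross_smul_N'_sub_smul_N_eq hh hc') (by fun_prop) (by fun_prop) (fun s => ?_) hab hper
    simp only [sub_self, cos_zero, sin_zero]
    ring
  all_goals exact Continuous.intervalIntegrable (by fun_prop) _ _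

/-- The area swept by the evolute of the envelope of `f`; up to rotation by a right angle the
evolute is the envelope of `f'`. -/
noncomputable def evoluteArea (f : ℝ → ℝ) : ℝ :=
  1 / 2 * ((∫ φ in (0 : ℝ)..2 * π, deriv f φ ^ 2) - ∫ φ in (0 : ℝ)..2 * π, deriv (deriv f) φ ^ 2)

lemma hasSweptArea_evolute {K : Set Plane} (hK : ContDiff ℝ 2 (supp K)) :
    HasSweptArea (evolute K) 0 (2 * π) (evoluteArea (supp K)) := by
  have hevolute : evolute K =
      fun φ => deriv (supp K) φ • N' φ - deriv (deriv (supp K)) φ • N φ := by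
    funext φ
    simp only [evolute, boundary, envelope, curvRadius]
    module
  have hper := periodic_deriv (supp_periodic K)
  rw [hevolute]
  refine hasSweptArea_smul_N'_sub_smul_N
    (fun φ => (hK.differentiable_deriv_two φ).hasDerivAt) (continuous_deriv_deriv hK) two_pi_pos ?_
  rw [← hper.eq, ← (periodic_deriv hper).eq]

/-! ### Fourier coefficients -/

/-- The complex Fourier coefficients over one period `[0, 2π]` of a real function. -/
noncomputable def fourierCoef (f : ℝ → ℝ) (n : ℤ) : ℂ :=
  fourierCoeffOn two_pi_pos (fun x => (f x : ℂ)) n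

/-- The energy of the `n`-th harmonic of `f`. -/
noncomputable def energy (f : ℝ → ℝ) (n : ℤ) : ℝ := ‖fourierCoef f n‖ ^ 2

lemma fourier_coe_eq_cos_add_sin {T : ℝ} (hT : T = 2 * π) (n : ℤ) (x : ℝ) :
    (fourier n (x : AddCircle T) : ℂ) = (cos (n * x) : ℂ) + (sin (n * x) : ℂ) * Complex.I := by
  subst hT
  have hπ : (π : ℂ) ≠ 0 := by exact_mod_cast pi_ne_zero
  have hexponent : 2 * (π : ℂ) * Complex.I * n * x / ((2 * π : ℝ) : ℂ) =
      ((n * x : ℝ) : ℂ) * Complex.I := by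
    push_cast
    field_simp
  rw [fourier_coe_apply, hexponent, Complex.exp_mul_I, ← Complex.ofReal_cos, ← Complex.ofReal_sin]

lemma integral_fourier_smul {T : ℝ} (hT : T = 2 * π) {f : ℝ → ℝ} (hf : Continuous f) (n : ℤ) :
    ∫ x in (0 : ℝ)..2 * π, fourier (-n) (x : AddCircle T) • (f x : ℂ) =
      ((∫ x in (0 : ℝ)..2 * π, f x * cos (n * x) : ℝ) : ℂ) -
        Complex.I * ((∫ x in (0 : ℝ)..2 * π, f x * sin (n * x) : ℝ) : ℂ) := by
  rw [← intervalIntegral.integral_ofReal, ← intervalIntegral.integral_ofReal,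
    ← intervalIntegral.integral_const_mul, ← intervalIntegral.integral_sub]
  · refine intervalIntegral.integral_congr fun x _ => ?_
    simp only [fourier_coe_eq_cos_add_sin hT, Int.cast_neg, neg_mul, cos_neg, sin_neg, smul_eq_mul]
    push_cast
    ring
  all_goals exact Continuous.intervalIntegrable (by fun_prop) _ _

lemma fourierCoef_eq {f : ℝ → ℝ} (hf : Continuous f) (n : ℤ) :
    fourierCoef f n = 1 / (2 * π) *
      (((∫ x in (0 : ℝ)..2 * π, f x * cos (n * x) : ℝ) : ℂ) -
        Complex.I * ((∫ x in (0 : ℝ)..2 * π, f x * sin (n * x) : ℝ) : ℂ)) := by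
  rw [fourierCoef, fourierCoeffOn_eq_integral, integral_fourier_smul (sub_zero _) hf, sub_zero,
    Complex.real_smul]
  push_cast
  rfl

lemma energy_nonneg (f : ℝ → ℝ) (n : ℤ) : 0 ≤ energy f n := sq_nonneg _

lemma energy_eq_zero_iff {f : ℝ → ℝ} {n : ℤ} : energy f n = 0 ↔ fourierCoef f n = 0 := by
  rw [energy, sq_eq_zero_iff, norm_eq_zero]

lemma energy_eq {f : ℝ → ℝ} (hf : Continuous f) (n : ℤ) :
    energy f n = ((∫ x in (0 : ℝ)..2 * π, f x * cos (n * x)) ^ 2 +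
      (∫ x in (0 : ℝ)..2 * π, f x * sin (n * x)) ^ 2) / (4 * π ^ 2) := by
  rw [energy, fourierCoef_eq hf]
  generalize ∫ x in (0 : ℝ)..2 * π, f x * cos (n * x) = a
  generalize ∫ x in (0 : ℝ)..2 * π, f x * sin (n * x) = b
  have hcartesian : (1 / (2 * π) * ((a : ℂ) - Complex.I * (b : ℂ)) : ℂ) =
      ((a / (2 * π) : ℝ) : ℂ) + ((-b / (2 * π) : ℝ) : ℂ) * Complex.I := by
    push_cast
    ring
  rw [hcartesian, Complex.sq_norm, Complex.normSq_add_mul_I]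
  ring

lemma energy_neg {f : ℝ → ℝ} (hf : Continuous f) (n : ℤ) : energy f (-n) = energy f n := by
  simp only [energy_eq hf, Int.cast_neg, neg_mul, cos_neg, sin_neg, mul_neg,
    intervalIntegral.integral_neg, neg_sq]

lemma hasSum_energy {f : ℝ → ℝ} (hf : Continuous f) :
    HasSum (fun n => energy f n) (1 / (2 * π) * ∫ x in (0 : ℝ)..2 * π, f x ^ 2) := by
  have hcont : Continuous fun x => (f x : ℂ) := by fun_prop
  obtain ⟨C, hC⟩ := (isCompact_Icc (a := 0) (b := 2 * π)).exists_bound_of_continuousOn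
    hcont.continuousOn
  have hL2 : MemLp (fun x => (f x : ℂ)) 2 (volume.restrict (Set.Ioc 0 (2 * π))) :=
    MemLp.of_bound hcont.aestronglyMeasurable C ((ae_restrict_iff' measurableSet_Ioc).2
      (.of_forall fun x hx => hC x (Set.Ioc_subset_Icc_self hx)))
  simpa only [energy, fourierCoef, sub_zero, smul_eq_mul, Complex.norm_real, norm_eq_abs, sq_abs,
    one_div] using hasSum_sq_fourierCoeffOn two_pi_pos hL2

lemma fourierCoef_deriv {f f' : ℝ → ℝ} (hf : ∀ x, HasDerivAt f (f' x) x) (hf' : Continuous f')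
    (hper : Function.Periodic f (2 * π)) (n : ℤ) :
    fourierCoef f' n = Complex.I * n * fourierCoef f n := by
  rcases eq_or_ne n 0 with rfl | hn
  · rw [fourierCoef_eq hf']
    simp [intervalIntegral_deriv_eq_zero hf hf' hper.eq.symm]
  · have hn' : (n : ℂ) ≠ 0 := by exact_mod_cast hn
    have hπ : (π : ℂ) ≠ 0 := by exact_mod_cast pi_ne_zero
    have hI := Complex.I_ne_zero
    have hparts := fourierCoeffOn_of_hasDerivAt two_pi_pos (f := fun x => (f x : ℂ))
      (f' := fun x => (f' x : ℂ)) hn (fun x _ => (hf x).ofReal_comp)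
      (Continuous.intervalIntegrable (by fun_prop) _ _)
    rw [fourierCoef, fourierCoef, hparts, hper.eq]
    push_cast
    field_simp
    ring

lemma energy_deriv {f : ℝ → ℝ} (hf : ContDiff ℝ 1 f) (hper : Function.Periodic f (2 * π)) (n : ℤ) :
    energy (deriv f) n = (n : ℝ) ^ 2 * energy f n := by
  rw [energy, fourierCoef_deriv (fun x => (hf.differentiable_one x).hasDerivAt)
    hf.continuous_deriv_one hper, norm_mul, norm_mul, Complex.norm_I, one_mul,
    Complex.norm_intCast, mul_pow, sq_abs, energy]

lemma hasSum_sq_mul_energy {f : ℝ → ℝ} (hf : ContDiff ℝ 1 f)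
    (hper : Function.Periodic f (2 * π)) :
    HasSum (fun n : ℤ => (n : ℝ) ^ 2 * energy f n)
      (1 / (2 * π) * ∫ x in (0 : ℝ)..2 * π, deriv f x ^ 2) := by
  simpa only [energy_deriv hf hper] using hasSum_energy hf.continuous_deriv_one

lemma hasSum_pow_four_mul_energy {f : ℝ → ℝ} (hf : ContDiff ℝ 2 f)
    (hper : Function.Periodic f (2 * π)) :
    HasSum (fun n : ℤ => (n : ℝ) ^ 4 * energy f n)
      (1 / (2 * π) * ∫ x in (0 : ℝ)..2 * π, deriv (deriv f) x ^ 2) := by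
  have hsum := hasSum_sq_mul_energy (f := deriv f) (ContDiff.deriv' hf) (periodic_deriv hper)
  simp only [energy_deriv (hf.of_le one_le_two) hper] at hsum
  exact hsum.congr_fun fun n => by ring

/-! ### Trigonometric polynomials -/

lemma fourierCoef_add {f g : ℝ → ℝ} (hf : Continuous f) (hg : Continuous g) (n : ℤ) :
    fourierCoef (fun x => f x + g x) n = fourierCoef f n + fourierCoef g n := by
  rw [fourierCoef_eq hf, fourierCoef_eq hg, fourierCoef_eq (by fun_prop)]
  simp only [add_mul]
  rw [intervalIntegral.integral_add, intervalIntegral.integral_add]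
  · push_cast
    ring
  all_goals exact Continuous.intervalIntegrable (by fun_prop) _ _

lemma fourierCoef_const_mul {f : ℝ → ℝ} (hf : Continuous f) (c : ℝ) (n : ℤ) :
    fourierCoef (fun x => c * f x) n = c * fourierCoef f n := by
  rw [fourierCoef_eq hf, fourierCoef_eq (by fun_prop)]
  simp only [mul_assoc, intervalIntegral.integral_const_mul]
  push_cast
  ring

lemma fourierCoef_sum {ι : Type*} (s : Finset ι) {f : ι → ℝ → ℝ} (hf : ∀ i ∈ s, Continuous (f i))
    (n : ℤ) : fourierCoef (fun x => ∑ i ∈ s, f i x) n = ∑ i ∈ s, fourierCoef (f i) n := by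
  rw [fourierCoef_eq (continuous_finsetSum s hf),
    Finset.sum_congr rfl fun i hi => fourierCoef_eq (hf i hi) n]
  simp only [Finset.sum_mul]
  rw [intervalIntegral.integral_finsetSum, intervalIntegral.integral_finsetSum,
    ← Finset.mul_sum, Finset.sum_sub_distrib, ← Finset.mul_sum]
  · push_cast
    rfl
  all_goals
    intro i hi
    have := hf i hi
    exact Continuous.intervalIntegrable (by fun_prop) _ _

lemma fourierCoef_cos_sin_eq_zero {k : ℕ} {n : ℤ} (h : |n| ≠ k) :
    fourierCoef (fun x => cos (k * x)) n = 0 ∧ fourierCoef (fun x => sin (k * x)) n = 0 := by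
  have hcos (x : ℝ) : HasDerivAt (fun x => cos (k * x)) (-k * sin (k * x)) x :=
    ((hasDerivAt_id' x).const_mul (k : ℝ)).cos.congr_deriv (by ring)
  have hsin (x : ℝ) : HasDerivAt (fun x => sin (k * x)) (k * cos (k * x)) x :=
    ((hasDerivAt_id' x).const_mul (k : ℝ)).sin.congr_deriv (by ring)
  have hcos_coef := fourierCoef_deriv hcos (by fun_prop)
    (fun x => by simp only [mul_add, cos_add_nat_mul_two_pi]) n
  have hsin_coef := fourierCoef_deriv hsin (by fun_prop)
    (fun x => by simp only [mul_add, sin_add_nat_mul_two_pi]) n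
  rw [fourierCoef_const_mul (by fun_prop)] at hcos_coef hsin_coef
  push_cast at hcos_coef hsin_coef
  have hne : (n : ℂ) ^ 2 - (k : ℂ) ^ 2 ≠ 0 := by
    rw [sub_ne_zero]
    norm_cast
    rw [← sq_abs]
    exact fun hsq => h ((pow_left_inj₀ (abs_nonneg n) k.cast_nonneg two_ne_zero).1
      (by exact_mod_cast hsq))
  constructor
  · refine (mul_eq_zero.1 ?_).resolve_left hne
    linear_combination (Complex.I * n) * hcos_coef - (k : ℂ) * hsin_coef +
      n ^ 2 * fourierCoef (fun x => cos (k * x)) n * Complex.I_sq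
  · refine (mul_eq_zero.1 ?_).resolve_left hne
    linear_combination (Complex.I * n) * hsin_coef + (k : ℂ) * hcos_coef +
      n ^ 2 * fourierCoef (fun x => sin (k * x)) n * Complex.I_sq

/-- Trigonometric polynomials of degree at most `d`. -/
def IsTrigPolynomial (d : ℕ) (f : ℝ → ℝ) : Prop :=
  ∃ a b : ℕ → ℝ, ∀ x, f x = ∑ k ∈ Finset.range (d + 1), (a k * cos (k * x) + b k * sin (k * x))

lemma isTrigPolynomial_cos_add_sin {d k : ℕ} (hk : k ≤ d) (a b : ℝ) :
    IsTrigPolynomial d fun x => a * cos (k * x) + b * sin (k * x) := by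
  refine ⟨Pi.single k a, Pi.single k b, fun x => ?_⟩
  rw [Finset.sum_eq_single k (fun j _ hj => by simp [hj])
    (fun h => absurd (Finset.mem_range_succ_iff.2 hk) h)]
  simp only [Pi.single_eq_same]

lemma isTrigPolynomial_const (d : ℕ) (c : ℝ) : IsTrigPolynomial d fun _ => c := by
  simpa using isTrigPolynomial_cos_add_sin d.zero_le c 0

lemma isTrigPolynomial_mul_sin_sub {d k : ℕ} (hk : k ≤ d) (r α : ℝ) :
    IsTrigPolynomial d fun x => r * sin (k * (x - α)) := by
  convert isTrigPolynomial_cos_add_sin hk (-(r * sin (k * α))) (r * cos (k * α)) using 2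
  rw [mul_sub, sin_sub]
  ring

lemma IsTrigPolynomial.add {d : ℕ} {f g : ℝ → ℝ} (hf : IsTrigPolynomial d f)
    (hg : IsTrigPolynomial d g) : IsTrigPolynomial d fun x => f x + g x := by
  obtain ⟨a, b, hab⟩ := hf
  obtain ⟨a', b', hab'⟩ := hg
  refine ⟨a + a', b + b', fun x => ?_⟩
  simp only [hab, hab', ← Finset.sum_add_distrib, Pi.add_apply]
  exact Finset.sum_congr rfl fun k _ => by ring

lemma isTrigPolynomial_sum {ι : Type*} {d : ℕ} (s : Finset ι) {f : ι → ℝ → ℝ}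
    (hf : ∀ i ∈ s, IsTrigPolynomial d (f i)) : IsTrigPolynomial d fun x => ∑ i ∈ s, f i x := by
  classical
  induction s using Finset.induction_on with
  | empty => simpa using isTrigPolynomial_const d 0
  | insert i s hi ih =>
    simp only [Finset.sum_insert hi]
    exact (hf i (Finset.mem_insert_self i s)).add
      (ih fun j hj => hf j (Finset.mem_insert_of_mem hj))

lemma IsTrigPolynomial.fourierCoef_eq_zero {d : ℕ} {f : ℝ → ℝ} (hf : IsTrigPolynomial d f) {n : ℤ}
    (hn : d < |n|) : fourierCoef f n = 0 := by
  obtain ⟨a, b, hab⟩ := hf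
  rw [funext hab, fourierCoef_sum _ fun k _ => by fun_prop]
  refine Finset.sum_eq_zero fun k hk => ?_
  have hne : |n| ≠ k := by
    rw [Finset.mem_range] at hk
    omega
  rw [fourierCoef_add (by fun_prop) (by fun_prop), fourierCoef_const_mul (by fun_prop),
    fourierCoef_const_mul (by fun_prop), (fourierCoef_cos_sin_eq_zero hne).1,
    (fourierCoef_cos_sin_eq_zero hne).2, mul_zero, mul_zero, add_zero]

lemma isTrigPolynomial_re_mul_fourier {d : ℕ} {n : ℤ} (hn : |n| ≤ d) (c : ℂ) :
    IsTrigPolynomial d fun x => (c * fourier n (x : AddCircle (2 * π))).re := by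
  have hre (x : ℝ) : (c * fourier n (x : AddCircle (2 * π))).re =
      c.re * cos (n * x) - c.im * sin (n * x) := by
    rw [fourier_coe_eq_cos_add_sin rfl]
    simp [Complex.mul_re, -Complex.ofReal_cos, -Complex.ofReal_sin]
  simp only [hre]
  obtain ⟨k, rfl | rfl⟩ := n.eq_nat_or_neg
  · simpa [sub_eq_add_neg] using isTrigPolynomial_cos_add_sin (by simpa using hn) c.re (-c.im)
  · simpa using isTrigPolynomial_cos_add_sin (by simpa using hn) c.re c.im

lemma exists_continuousMap_addCircle {f : ℝ → ℝ} (hf : Continuous f)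
    (hper : Function.Periodic f (2 * π)) [Fact (0 < 2 * π)] :
    ∃ F : C(AddCircle (2 * π), ℂ), (∀ x : ℝ, F x = f x) ∧
      ∀ n, fourierCoeff F n = fourierCoef f n := by
  have hper' : Function.Periodic (fun x => (f x : ℂ)) (2 * π) := fun x => by simp only [hper x]
  refine ⟨⟨hper'.lift, continuous_coinduced_dom.2 (Complex.continuous_ofReal.comp hf)⟩,
    fun _ => rfl, fun n => ?_⟩
  rw [fourierCoeff_eq_intervalIntegral _ n 0, zero_add, fourierCoef_eq hf,
    ← integral_fourier_smul rfl hf n, Complex.real_smul]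
  push_cast
  rfl

lemma isTrigPolynomial_of_fourierCoef_eq_zero {d : ℕ} {f : ℝ → ℝ} (hf : Continuous f)
    (hper : Function.Periodic f (2 * π)) (h : ∀ n : ℤ, d < |n| → fourierCoef f n = 0) :
    IsTrigPolynomial d f := by
  have : Fact (0 < 2 * π) := ⟨two_pi_pos⟩
  obtain ⟨F, hF, hcoeff⟩ := exists_continuousMap_addCircle hf hper
  have hmem {n : ℤ} : n ∈ Finset.Icc (-d : ℤ) d ↔ |n| ≤ d := by rw [Finset.mem_Icc, abs_le]
  have hzero : ∀ n ∉ Finset.Icc (-d : ℤ) d, fourierCoeff F n = 0 := fun n hn => by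
    rw [hcoeff]
    exact h n (not_le.1 (mt hmem.2 hn))
  have hsum (x : ℝ) : f x = ∑ n ∈ Finset.Icc (-d : ℤ) d,
      (fourierCoeff F n * fourier n (x : AddCircle (2 * π))).re := by
    have hseries := (has_pointwise_sum_fourier_series_of_summable
      (summable_of_ne_finset_zero hzero) (x : AddCircle (2 * π))).unique
      (hasSum_sum_of_ne_finset_zero fun n hn => by rw [hzero n hn, zero_smul])
    rw [hF] at hseries
    simpa only [Complex.ofReal_re, Complex.re_sum, smul_eq_mul] using congrArg Complex.re hseries
  rw [funext hsum]
  exact isTrigPolynomial_sum _ fun n hn => isTrigPolynomial_re_mul_fourier (hmem.1 hn) _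

lemma isTrigPolynomial_iff_energy_eq_zero {d : ℕ} {f : ℝ → ℝ} (hf : Continuous f)
    (hper : Function.Periodic f (2 * π)) :
    IsTrigPolynomial d f ↔ ∀ n : ℤ, d < |n| → energy f n = 0 := by
  simp only [energy_eq_zero_iff]
  exact ⟨fun h _ hn => h.fourierCoef_eq_zero hn, isTrigPolynomial_of_fourierCoef_eq_zero hf hper⟩

lemma integral_cos_sin_sum {d : ℕ} (a b : ℕ → ℝ) :
    ∫ x in (0 : ℝ)..2 * π,
      ∑ k ∈ Finset.range (d + 1), (a k * cos (k * x) + b k * sin (k * x)) = 2 * π * a 0 := by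
  rw [intervalIntegral.integral_finsetSum fun k _ =>
    Continuous.intervalIntegrable (by fun_prop) _ _, Finset.sum_range_succ', Finset.sum_eq_zero]
  · simp
  · intro k _
    have hk : ((k + 1 : ℕ) : ℝ) ≠ 0 := by exact_mod_cast k.succ_ne_zero
    have hsin := sin_add_nat_mul_two_pi 0 (k + 1)
    rw [zero_add, sin_zero] at hsin
    rw [intervalIntegral.integral_add, intervalIntegral.integral_const_mul,
      intervalIntegral.integral_const_mul, intervalIntegral.integral_comp_mul_left cos hk,
      intervalIntegral.integral_comp_mul_left sin hk, integral_cos, integral_sin, mul_zero,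
      hsin, cos_nat_mul_two_pi, sin_zero, cos_zero, sub_self, smul_zero,
      mul_zero, sub_self, smul_zero, mul_zero, add_zero]
    all_goals exact Continuous.intervalIntegrable (by fun_prop) _ _

/-! ### The inequality in terms of harmonics -/

lemma hasSum_evoluteArea {f : ℝ → ℝ} (hf : ContDiff ℝ 2 f)
    (hper : Function.Periodic f (2 * π)) :
    HasSum (fun n : ℤ => (n : ℝ) ^ 2 * ((n : ℝ) ^ 2 - 1) * energy f n) (-evoluteArea f / π) := by
  have hvalue : -evoluteArea f / π = (1 / (2 * π) * ∫ x in (0 : ℝ)..2 * π, deriv (deriv f) x ^ 2) -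
      1 / (2 * π) * ∫ x in (0 : ℝ)..2 * π, deriv f x ^ 2 := by
    rw [evoluteArea]
    ring
  rw [hvalue]
  exact ((hasSum_pow_four_mul_energy hf hper).sub
    (hasSum_sq_mul_energy (hf.of_le one_le_two) hper)).congr_fun fun n => by ring

lemma sq_le_sq_of_le_abs {m : ℕ} {n : ℤ} (h : m ≤ |n|) : (m : ℝ) ^ 2 ≤ (n : ℝ) ^ 2 := by
  rw [← Nat.abs_cast m] at h
  exact_mod_cast sq_le_sq.2 h

lemma evoluteArea_nonpos {f : ℝ → ℝ} (hf : ContDiff ℝ 2 f)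
    (hper : Function.Periodic f (2 * π)) : evoluteArea f ≤ 0 := by
  have hnonneg := (hasSum_evoluteArea hf hper).nonneg fun n => by
    refine mul_nonneg ?_ (energy_nonneg f n)
    rcases eq_or_ne n 0 with rfl | hn
    · simp
    · have hsq := sq_le_sq_of_le_abs (m := 1) (by exact_mod_cast Int.one_le_abs hn)
      rw [Nat.cast_one, one_pow] at hsq
      exact mul_nonneg (sq_nonneg _) (sub_nonneg.2 hsq)
  rwa [le_div_iff₀ pi_pos, zero_mul, neg_nonneg] at hnonneg

lemma hasSum_indicator_mul_nonneg {ι : Type*} {s : Set ι} {w e : ι → ℝ} {S : ℝ}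
    (hw : ∀ i ∈ s, 0 < w i) (he : ∀ i, 0 ≤ e i)
    (hsum : HasSum (s.indicator fun i => w i * e i) S) : 0 ≤ S :=
  hsum.nonneg (Set.indicator_nonneg fun i hi => mul_nonneg (hw i hi).le (he i))

lemma hasSum_indicator_mul_eq_zero_iff {ι : Type*} {s : Set ι} {w e : ι → ℝ} {S : ℝ}
    (hw : ∀ i ∈ s, 0 < w i) (he : ∀ i, 0 ≤ e i)
    (hsum : HasSum (s.indicator fun i => w i * e i) S) : S = 0 ↔ ∀ i ∈ s, e i = 0 := by
  have hterms : S = 0 ↔ s.indicator (fun i => w i * e i) = 0 := by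
    rw [← hasSum_zero_iff_of_nonneg (L := .unconditional ι)
      (Set.indicator_nonneg fun i hi => mul_nonneg (hw i hi).le (he i))]
    exact ⟨fun h => h ▸ hsum, hsum.unique⟩
  rw [hterms, Set.indicator_eq_zero', Set.disjoint_right]
  refine forall₂_congr fun i hi => ?_
  rw [Function.notMem_support, mul_eq_zero, or_iff_right (hw i hi).ne']

lemma sub_nine_mul_pos {n : ℤ} (hn : 3 < |n|) :
    0 < ((n : ℝ) ^ 2 - 9) * ((n : ℝ) ^ 2 - 4 / 9) := by
  have hsq := sq_le_sq_of_le_abs (m := 4) (Int.add_one_le_iff.2 hn)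
  norm_num at hsq
  exact mul_pos (by linarith) (by linarith)

namespace IsSmoothBody

variable {K : Set Plane} (hK : IsSmoothBody K)
include hK

lemma perimeter_sq_eq : perimeter K ^ 2 = 4 * π ^ 2 * energy (supp K) 0 := by
  rw [energy_eq hK.isSmoothSupport.contDiff.continuous, hK.perimeter_eq]
  simp only [Int.cast_zero, zero_mul, cos_zero, mul_one, sin_zero, mul_zero,
    intervalIntegral.integral_zero, ne_eq, OfNat.ofNat_ne_zero, not_false_eq_true, zero_pow,
    add_zero]
  field_simp

lemma hasSum_deficit :
    HasSum (fun n : ℤ => (if n = 0 then 0 else 4 * ((n : ℝ) ^ 2 - 1)) * energy (supp K) n)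
      (deficit K / π ^ 2) := by
  have hf := hK.isSmoothSupport
  have hvalue : deficit K / π ^ 2 =
      4 * ((1 / (2 * π) * ∫ x in (0 : ℝ)..2 * π, deriv (supp K) x ^ 2) -
        1 / (2 * π) * ∫ x in (0 : ℝ)..2 * π, supp K x ^ 2) + 4 * energy (supp K) 0 := by
    rw [deficit, hK.area_eq, hK.perimeter_sq_eq]
    field_simp
    ring
  rw [hvalue]
  refine ((((hasSum_sq_mul_energy (hf.contDiff.of_le one_le_two) hf.periodic).sub
    (hasSum_energy hf.contDiff.continuous)).mul_left 4).add
    (hasSum_ite_eq 0 (4 * energy (supp K) 0))).congr_fun fun n => ?_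
  split_ifs with hn
  · simp [hn]
  · ring

lemma hasSum_evoluteArea_sub_deficit :
    HasSum ({n : ℤ | 2 < |n|}.indicator fun n =>
        ((n : ℝ) ^ 2 - 1) * ((n : ℝ) ^ 2 - 4) * energy (supp K) n)
      ((π * |evoluteArea (supp K)| - deficit K) / π ^ 2) := by
  have hf := hK.isSmoothSupport
  have hvalue : (π * |evoluteArea (supp K)| - deficit K) / π ^ 2 =
      -evoluteArea (supp K) / π - deficit K / π ^ 2 := by
    rw [abs_of_nonpos (evoluteArea_nonpos hf.contDiff hf.periodic)]
    field_simp
  rw [hvalue]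
  refine ((hasSum_evoluteArea hf.contDiff hf.periodic).sub hK.hasSum_deficit).congr_fun fun n => ?_
  simp only [Set.indicator_apply, Set.mem_ofPred_eq]
  split_ifs with hn hn0 hn0
  · simp [hn0] at hn
  · ring
  · simp [hn0]
  · obtain ⟨hlower, hupper⟩ := abs_le.1 (not_lt.1 hn)
    interval_cases n <;> first | exact absurd rfl hn0 | norm_num

lemma pedalBound_eq :
    pedalBound K = 40 / 9 * π ^ 2 * (1 / (2 * π) * (∫ φ in (0 : ℝ)..2 * π, deriv (supp K) φ ^ 2) -
      (2 * energy (supp K) 1 + 8 * energy (supp K) 2)) := by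
  have hf := hK.isSmoothSupport.contDiff.continuous
  rw [pedalBound, hK.pedalArea_eq, hK.area_eq, hK.integral_sin_visualAngle_cubed,
    ← hK.perimeter_eq, energy_eq hf, energy_eq hf]
  push_cast
  simp only [one_mul]
  field_simp
  ring

lemma hasSum_pedalBound :
    HasSum ({n : ℤ | 2 < |n|}.indicator fun n => 40 / 9 * (n : ℝ) ^ 2 * energy (supp K) n)
      (pedalBound K / π ^ 2) := by
  have hf := hK.isSmoothSupport
  have hcont := hf.contDiff.continuous
  have hlow : ∑ n ∈ ({-2, -1, 0, 1, 2} : Finset ℤ), (n : ℝ) ^ 2 * energy (supp K) n =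
      2 * energy (supp K) 1 + 8 * energy (supp K) 2 := by
    simp [energy_neg hcont]
    ring
  have hvalue : pedalBound K / π ^ 2 =
      40 / 9 * ((1 / (2 * π) * ∫ φ in (0 : ℝ)..2 * π, deriv (supp K) φ ^ 2) -
        ∑ n ∈ ({-2, -1, 0, 1, 2} : Finset ℤ), (n : ℝ) ^ 2 * energy (supp K) n) := by
    rw [hlow, hK.pedalBound_eq]
    field_simp
  rw [hvalue]
  refine (((hasSum_sq_mul_energy (hf.contDiff.of_le one_le_two) hf.periodic).sub
    ((hasSum_subtype_iff_indicator).1 (Finset.hasSum _ _))).mul_left (40 / 9)).congr_fun fun n => ?_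
  have hmem : n ∈ ({-2, -1, 0, 1, 2} : Finset ℤ) ↔ ¬2 < |n| := by
    simp only [Finset.mem_insert, Finset.mem_singleton]
    rcases abs_cases n with h | h <;> omega
  simp only [Set.indicator_apply, Set.mem_ofPred_eq, Finset.mem_coe, hmem]
  split_ifs <;> ring

-- The coefficients `(n² - 1)(n² - 4)` and `(40/9) n²` agree at `|n| = 3`.
lemma hasSum_evoluteArea_sub_deficit_sub_pedalBound :
    HasSum ({n : ℤ | 3 < |n|}.indicator fun n =>
        ((n : ℝ) ^ 2 - 9) * ((n : ℝ) ^ 2 - 4 / 9) * energy (supp K) n)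
      ((π * |evoluteArea (supp K)| - deficit K - pedalBound K) / π ^ 2) := by
  rw [sub_div]
  refine (hK.hasSum_evoluteArea_sub_deficit.sub hK.hasSum_pedalBound).congr_fun fun n => ?_
  simp only [Set.indicator_apply, Set.mem_ofPred_eq]
  split_ifs with h3 h2 h2
  · ring
  · omega
  · have hsq : (n : ℝ) ^ 2 = 9 := by
      rw [← sq_abs, show |(n : ℝ)| = 3 by exact_mod_cast (by omega : |n| = 3)]
      norm_num
    rw [hsq]
    ring
  · ring

lemma evoluteArea_sub_deficit_eq_zero_iff :
    π * |evoluteArea (supp K)| - deficit K = 0 ↔ ∀ n : ℤ, 2 < |n| → energy (supp K) n = 0 := by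
  refine Iff.trans ?_ (hasSum_indicator_mul_eq_zero_iff (fun n hn => ?_) (energy_nonneg _)
    hK.hasSum_evoluteArea_sub_deficit)
  · rw [div_eq_zero_iff, or_iff_left (pow_ne_zero 2 pi_ne_zero)]
  · have hsq := sq_le_sq_of_le_abs (m := 3) (Int.add_one_le_iff.2 hn)
    norm_num at hsq
    exact mul_pos (by linarith) (by linarith)

lemma pedalBound_nonneg : 0 ≤ pedalBound K := by
  have hnonneg := hasSum_indicator_mul_nonneg (fun n hn => ?_) (energy_nonneg _)
    hK.hasSum_pedalBound
  · rwa [le_div_iff₀ (by positivity), zero_mul] at hnonneg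
  · have hsq := sq_le_sq_of_le_abs (m := 3) (Int.add_one_le_iff.2 hn)
    norm_num at hsq
    linarith

lemma pedalBound_eq_zero_iff :
    pedalBound K = 0 ↔ ∀ n : ℤ, 2 < |n| → energy (supp K) n = 0 := by
  refine Iff.trans ?_ (hasSum_indicator_mul_eq_zero_iff (fun n hn => ?_) (energy_nonneg _)
    hK.hasSum_pedalBound)
  · rw [div_eq_zero_iff, or_iff_left (pow_ne_zero 2 pi_ne_zero)]
  · have hsq := sq_le_sq_of_le_abs (m := 3) (Int.add_one_le_iff.2 hn)
    norm_num at hsq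
    linarith

lemma pedalBound_le : pedalBound K ≤ π * |evoluteArea (supp K)| - deficit K := by
  have hnonneg := hasSum_indicator_mul_nonneg (fun n hn => sub_nine_mul_pos hn) (energy_nonneg _)
    hK.hasSum_evoluteArea_sub_deficit_sub_pedalBound
  rwa [le_div_iff₀ (by positivity), zero_mul, sub_nonneg] at hnonneg

lemma evoluteArea_sub_deficit_eq_pedalBound_iff :
    π * |evoluteArea (supp K)| - deficit K = pedalBound K ↔ IsTrigPolynomial 3 (supp K) := by
  rw [isTrigPolynomial_iff_energy_eq_zero hK.isSmoothSupport.contDiff.continuous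
    hK.isSmoothSupport.periodic, ← sub_eq_zero]
  refine Iff.trans ?_ (hasSum_indicator_mul_eq_zero_iff (fun n hn => sub_nine_mul_pos hn)
    (energy_nonneg _) hK.hasSum_evoluteArea_sub_deficit_sub_pedalBound)
  rw [div_eq_zero_iff, or_iff_left (pow_ne_zero 2 pi_ne_zero)]

end IsSmoothBody

/-! ### Disks and hypocycloids -/

lemma supp_closedBall (c : Plane) {ρ : ℝ} (hρ : 0 ≤ ρ) (φ : ℝ) :
    supp (Metric.closedBall c ρ) φ = inner ℝ c (N φ) + ρ := by
  refine IsGreatest.csSup_eq ⟨⟨c + ρ • N φ, ?_, ?_⟩, ?_⟩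
  · simp [norm_smul, norm_N, abs_of_nonneg hρ]
  · simp only [inner_add_left, inner_smul_left, inner_N_N, conj_trivial, sub_self, cos_zero,
      mul_one]
  · rintro _ ⟨x, hx, rfl⟩
    have hdist : inner ℝ (x - c) (N φ) ≤ ρ :=
      (real_inner_le_norm _ _).trans (by simpa [norm_N, dist_eq_norm] using hx)
    rw [inner_sub_left] at hdist
    linarith

lemma inner_rotate (α : ℝ) (x : Plane) (θ : ℝ) :
    inner ℝ (rotate α x) (N (θ + α)) = inner ℝ x (N θ) := by
  simp only [inner_N, rotate, Matrix.cons_val_zero, Matrix.cons_val_one, cos_add, sin_add]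
  linear_combination (x 0 * cos θ + x 1 * sin θ) * sin_sq_add_cos_sq α

lemma inner_hypocycloid (k : ℕ) (r t : ℝ) :
    inner ℝ (hypocycloid k r t) (N (((k : ℝ) - 2) / 2 * t)) =
      r * (k - 2) * sin ((k : ℝ) / 2 * t) := by
  set s := ((k : ℝ) - 2) / 2 * t with hs
  set u := (k : ℝ) / 2 * t with hu
  have hdiff : t = u - s := by rw [hs, hu]; ring
  have hsum : ((k : ℝ) - 1) * t = u + s := by rw [hs, hu]; ring
  simp only [inner_N, hypocycloid, Matrix.cons_val_zero, Matrix.cons_val_one, hsum]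
  rw [hdiff, sin_sub, cos_sub, sin_add, cos_add]
  linear_combination r * (k - 2) * sin u * sin_sq_add_cos_sq s

lemma envelope_harmonic_eq_hypocycloid (k m : ℕ) (hkm : (k : ℝ) = m * (k - 2)) (r α t : ℝ) :
    envelope (fun θ => r * (k - 2) * sin (m * (θ - α))) (((k : ℝ) - 2) / 2 * t + α) =
      rotate α (hypocycloid k r t) := by
  have hderiv (θ : ℝ) : HasDerivAt (fun θ => r * (k - 2) * sin (m * (θ - α)))
      (r * k * cos (m * (θ - α))) θ := by
    refine (((((hasDerivAt_id θ).sub_const α).const_mul _).sin).const_mul _).congr_deriv ?_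
    simp only [id]
    linear_combination (-r * cos (m * (θ - α))) * hkm
  set s := ((k : ℝ) - 2) / 2 * t with hs
  set u := (k : ℝ) / 2 * t with hu
  have hdiff : t = u - s := by rw [hs, hu]; ring
  have hsum : ((k : ℝ) - 1) * t = u + s := by rw [hs, hu]; ring
  have hmul : m * s = u := by rw [hs, hu]; linear_combination (-t / 2) * hkm
  rw [envelope, (hderiv _).deriv]
  apply plane_ext
  all_goals
    simp only [PiLp.add_apply, PiLp.smul_apply, N_zero, N_one, N'_zero, N'_one, smul_eq_mul, rotate,
      hypocycloid, Matrix.cons_val_zero, Matrix.cons_val_one, add_sub_cancel_right, hmul, hsum]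
    rw [hdiff, sin_sub, cos_sub]
    simp only [sin_add, cos_add]
    ring

/-! ### Shapes whose support function is a trigonometric polynomial -/

lemma isTrigPolynomial_inner_N {d : ℕ} (hd : 1 ≤ d) (v : Plane) :
    IsTrigPolynomial d fun φ => inner ℝ v (N φ) := by
  simpa [inner_N] using isTrigPolynomial_cos_add_sin hd (v 0) (v 1)

lemma IsDiskSupport.isTrigPolynomial {d : ℕ} (hd : 1 ≤ d) {f : ℝ → ℝ} (hf : IsDiskSupport f) :
    IsTrigPolynomial d f := by
  obtain ⟨c, ρ, hρ, rfl⟩ := hf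
  rw [funext (supp_closedBall c hρ.le)]
  exact (isTrigPolynomial_inner_N hd c).add (isTrigPolynomial_const d ρ)

lemma IsHypocycloidSupport.exists_eq_harmonic {k m : ℕ} (hkm : (k : ℝ) = m * (k - 2)) {f : ℝ → ℝ}
    (hf : IsHypocycloidSupport k f) :
    ∃ (r α : ℝ) (v : Plane), ∀ θ, f θ = r * sin (m * (θ - α)) + inner ℝ v (N θ) := by
  obtain ⟨-, r, -, α, v, henvelope⟩ := hf
  refine ⟨r * (k - 2), α, v, fun θ => ?_⟩
  have hk : (k : ℝ) - 2 ≠ 0 := fun h => by rw [h, mul_zero] at hkm; norm_num [hkm] at h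
  obtain ⟨t, rfl⟩ : ∃ t, ((k : ℝ) - 2) / 2 * t + α = θ :=
    ⟨2 / ((k : ℝ) - 2) * (θ - α), by field_simp; ring⟩
  have hmul : m * (((k : ℝ) - 2) / 2 * t) = (k : ℝ) / 2 * t := by linear_combination (-t / 2) * hkm
  rw [← inner_envelope_self f, henvelope, inner_add_left, inner_rotate, inner_hypocycloid,
    add_sub_cancel_right, hmul]

lemma IsParallelHypocycloidSupport.isTrigPolynomial {k m d : ℕ} (hkm : (k : ℝ) = m * (k - 2))
    (hd : 1 ≤ d) (hmd : m ≤ d) {f : ℝ → ℝ} (hf : IsParallelHypocycloidSupport k f) :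
    IsTrigPolynomial d f := by
  obtain ⟨g, c, hg, hfg⟩ := hf
  obtain ⟨r, α, v, hharmonic⟩ := hg.exists_eq_harmonic hkm
  rw [funext hfg, funext hharmonic]
  exact ((isTrigPolynomial_mul_sin_sub hmd r α).add (isTrigPolynomial_inner_N hd v)).add
    (isTrigPolynomial_const d c)

lemma IsBasicSupport.isTrigPolynomial {f : ℝ → ℝ} (hf : IsBasicSupport f) :
    IsTrigPolynomial 3 f := by
  rcases hf with hdisk | hastroid | hsteiner
  · exact hdisk.isTrigPolynomial (by norm_num)
  · exact hastroid.isTrigPolynomial (m := 2) (by norm_num) (by norm_num) (by norm_num)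
  · exact hsteiner.isTrigPolynomial (m := 3) (by norm_num) (by norm_num) (by norm_num)

/-! ### Decomposition into disks, astroids and Steiner curves -/

lemma exists_amplitude_phase {b c k : ℝ} (hk : k ≠ 0) (hbc : b ≠ 0 ∨ c ≠ 0) :
    ∃ R > 0, ∃ α, ∀ θ, b * cos (k * θ) + c * sin (k * θ) = R * sin (k * (θ - α)) := by
  obtain ⟨ψ, hψ⟩ := exists_eq_smul_N (!₂[c, -b] : Plane)
  set R := ‖(!₂[c, -b] : Plane)‖
  have hc : c = R * cos ψ := congrFun (congrArg WithLp.ofLp hψ) 0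
  have hb : -b = R * sin ψ := congrFun (congrArg WithLp.ofLp hψ) 1
  refine ⟨R, (norm_nonneg _).lt_of_ne' fun (hR0 : R = 0) => ?_, ψ / k, fun θ => ?_⟩
  · rw [hR0, zero_mul] at hb hc
    exact hbc.elim (· (neg_eq_zero.1 hb)) (· hc)
  · rw [mul_sub, mul_div_cancel₀ _ hk, sin_sub]
    linear_combination sin (k * θ) * hc - cos (k * θ) * hb

lemma isHypocycloidSupport_harmonic {k m : ℕ} (hkm : (k : ℝ) = m * (k - 2)) (hk : 2 < k) {b c : ℝ}
    (hbc : b ≠ 0 ∨ c ≠ 0) :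
    IsHypocycloidSupport k fun θ => b * cos (m * θ) + c * sin (m * θ) := by
  have hk2 : (0 : ℝ) < k - 2 := sub_pos.2 (by exact_mod_cast hk)
  have hm : (m : ℝ) ≠ 0 := fun h => by rw [h, zero_mul] at hkm; linarith
  obtain ⟨R, hR, α, hphase⟩ := exists_amplitude_phase hm hbc
  refine ⟨by fun_prop, R / (k - 2), div_pos hR hk2, α, 0, fun t => ?_⟩
  rw [add_zero, ← envelope_harmonic_eq_hypocycloid k m hkm, div_mul_cancel₀ R hk2.ne',
    funext hphase]

/-- Finite sums of generalized support functions of circles and of curves parallel to an astroid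
or to a Steiner curve; `IsMinkowskiSumOfBasic K` says that `supp K` is one. -/
def IsSumOfBasic (f : ℝ → ℝ) : Prop :=
  ∃ (n : ℕ) (F : Fin n → ℝ → ℝ), (∀ i, IsBasicSupport (F i)) ∧ ∀ φ, f φ = ∑ i, F i φ

lemma IsBasicSupport.isSumOfBasic {f : ℝ → ℝ} (hf : IsBasicSupport f) : IsSumOfBasic f :=
  ⟨1, fun _ => f, fun _ => hf, fun φ => by simp⟩

lemma IsSumOfBasic.add_basic {f g : ℝ → ℝ} (hg : IsSumOfBasic g) (hf : IsBasicSupport f) :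
    IsSumOfBasic fun φ => f φ + g φ := by
  obtain ⟨n, F, hF, hsum⟩ := hg
  exact ⟨n + 1, Fin.cons f F, Fin.cases hf hF, fun φ => by simp [Fin.sum_univ_succ, hsum]⟩

lemma IsSumOfBasic.add_harmonic {k m : ℕ} (hkm : (k : ℝ) = m * (k - 2)) (hk : k = 4 ∨ k = 3)
    {f : ℝ → ℝ} (hf : IsSumOfBasic f) (b c : ℝ) :
    IsSumOfBasic fun φ => (b * cos (m * φ) + c * sin (m * φ)) + f φ := by
  by_cases hbc : b ≠ 0 ∨ c ≠ 0
  · have hharmonic : IsParallelHypocycloidSupport k fun φ => b * cos (m * φ) + c * sin (m * φ) :=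
      ⟨_, 0, isHypocycloidSupport_harmonic hkm (by omega) hbc, fun φ => (add_zero _).symm⟩
    refine hf.add_basic (.inr ?_)
    rcases hk with rfl | rfl
    exacts [.inl hharmonic, .inr hharmonic]
  · push Not at hbc
    simpa [hbc.1, hbc.2] using hf

namespace IsSmoothBody

variable {K : Set Plane} (hK : IsSmoothBody K)
include hK

lemma isMinkowskiSumOfBasic (htrig : IsTrigPolynomial 3 (supp K)) : IsMinkowskiSumOfBasic K := by
  obtain ⟨a, b, hsupp⟩ := htrig
  have hradius : 0 < a 0 := by
    have hpos := hK.perimeter_pos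
    rw [hK.perimeter_eq, funext hsupp, integral_cos_sin_sum] at hpos
    exact pos_of_mul_pos_right hpos two_pi_pos.le
  have hdisk : IsBasicSupport (supp (Metric.closedBall (!₂[a 1, b 1] : Plane) (a 0))) :=
    .inl ⟨_, _, hradius, rfl⟩
  obtain ⟨n, F, hF, hsum⟩ := (hdisk.isSumOfBasic.add_harmonic (k := 4) (m := 2) (by norm_num)
    (.inl rfl) (a 2) (b 2)).add_harmonic (k := 3) (m := 3) (by norm_num) (.inr rfl) (a 3) (b 3)
  refine ⟨n, F, hF, fun φ => ?_⟩
  rw [← hsum φ, hsupp]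
  simp only [Finset.sum_range_succ, Finset.range_one, Nat.reduceAdd, Finset.sum_singleton,
    Nat.cast_zero, Nat.cast_one, Nat.cast_ofNat, zero_mul, one_mul, cos_zero, sin_zero, mul_one,
    mul_zero, add_zero, supp_closedBall _ hradius.le, inner_N, Matrix.cons_val_zero,
    Matrix.cons_val_one]
  ring

lemma isTrigPolynomial_iff_shape : IsTrigPolynomial 3 (supp K) ↔
    IsDiskOrParallelAstroid K ∨ IsParallelSteinerCurve K ∨ IsMinkowskiSumOfBasic K := by
  refine ⟨fun htrig => .inr (.inr (hK.isMinkowskiSumOfBasic htrig)), ?_⟩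
  rintro ((⟨c, ρ, hρ, rfl⟩ | hastroid) | hsteiner | ⟨n, f, hf, hsum⟩)
  · exact IsBasicSupport.isTrigPolynomial (.inl ⟨c, ρ, hρ, rfl⟩)
  · exact IsBasicSupport.isTrigPolynomial (.inr (.inl hastroid))
  · exact IsBasicSupport.isTrigPolynomial (.inr (.inr hsteiner))
  · rw [funext hsum]
    exact isTrigPolynomial_sum _ fun i _ => (hf i).isTrigPolynomial

end IsSmoothBody

end Hurwitz

theorem mainTheorem5 (K : Set Hurwitz.Plane) (hne : K.Nonempty) (hcpt : IsCompact K)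
    (hconv : Convex ℝ K) (hC2 : ContDiff ℝ 2 (Hurwitz.supp K))
    (hpos : ∀ φ : ℝ, 0 < Hurwitz.curvRadius K φ) :
    MeasureTheory.IntegrableOn (fun P => Real.sin (Hurwitz.visualAngle K P) ^ 3) Kᶜ ∧
    ∃ Fe : ℝ, Hurwitz.HasSweptArea (Hurwitz.evolute K) 0 (2 * Real.pi) Fe ∧
      Hurwitz.pedalBound K ≤ Real.pi * |Fe| - Hurwitz.deficit K ∧
      (Real.pi * |Fe| - Hurwitz.deficit K ≠ 0 → 0 < Hurwitz.pedalBound K) ∧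
      (Real.pi * |Fe| - Hurwitz.deficit K = 0 → Hurwitz.pedalBound K = 0) ∧
      (Real.pi * |Fe| - Hurwitz.deficit K = Hurwitz.pedalBound K ↔
        Hurwitz.IsDiskOrParallelAstroid K ∨ Hurwitz.IsParallelSteinerCurve K ∨
          Hurwitz.IsMinkowskiSumOfBasic K) := by
  have hK : Hurwitz.IsSmoothBody K := ⟨hne, hcpt, hconv, hC2, Hurwitz.supp_periodic K, hpos⟩
  refine ⟨hK.integrableOn_sin_visualAngle_cubed, Hurwitz.evoluteArea (Hurwitz.supp K),
    Hurwitz.hasSweptArea_evolute hC2, hK.pedalBound_le, fun hne0 => ?_, fun h0 => ?_, ?_⟩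
  · refine hK.pedalBound_nonneg.lt_of_ne' fun h0 => hne0 ?_
    exact hK.evoluteArea_sub_deficit_eq_zero_iff.2 (hK.pedalBound_eq_zero_iff.1 h0)
  · exact hK.pedalBound_eq_zero_iff.2 (hK.evoluteArea_sub_deficit_eq_zero_iff.1 h0)
  · exact hK.evoluteArea_sub_deficit_eq_pedalBound_iff.trans hK.isTrigPolynomial_iff_shape
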